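/- Let $m>0$ and $\omega_{\mathbf p}=\sqrt{|\mathbf p|^2+m^2}$ for $\mathbf p\in\mathbb R^3$. On the bosonic Fock space over $L^2(\mathbb R^3, d^3\mathbf p/(2\omega_{\mathbf p}))$ let $a_c(h)$ be the annihilation operators, $$(a_c(h)\Psi)_k(\mathbf p_1,\dots,\mathbf p_k)=\sqrt{k+1}\int \frac{d^3\mathbf p}{2\omega_{\mathbf p}}\,\overline{h(\mathbf p)}\,\Psi_{k+1}(\mathbf p,\mathbf p_1,\dots,\mathbf p_k),$$ on their maximal domains, write $a_c(h)=\int \frac{d^3\mathbf p}{2\omega_{\mathbf p}}\overline{h(\mathbf p)}a_c(\mathbf p)$, and let $$a(\mathbf p)=\frac{a_c(\mathbf p)}{\sqrt{2\omega_{\mathbf p}}},\qquad \tilde a(\mathbf x)=(2\pi)^{-3/2}\int d^3\mathbf p\,e^{i\mathbf p\cdot\mathbf x}a(\mathbf p)$$ be the coordinate space annihilation operator, an operator-valued distribution: $\tilde a(f)=\int f(\mathbf x)\tilde a(\mathbf x)\,d^3\mathbf x$ for Schwartz functions $f$. For $y=(y^0,\mathbf y)\in\mathbb R^4$ let $U(y,\mathbb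 I)$ be the unitary translation operator, which multiplies a $k$-particle wave function by $\exp\big(i\sum_{j}(\omega_{\mathbf p_j}y^0-\mathbf p_j\cdot\mathbf y)\big)$. Then, as an equality of operator-valued distributions in $\mathbf x$ (and of unbounded operators, including domains, after smearing with a Schwartz function $f(\mathbf x)$), $$U(y,\mathbb I)\,\tilde a(\mathbf x)\,U(y,\mathbb I)^{-1}=(k_{y^0}*\tilde a)(\mathbf x+\mathbf y)=\int d^3\mathbf z\;k_{y^0}(\mathbf x+\mathbf y-\mathbf z)\,\tilde a(\mathbf z),$$ where $k_{y^0}$ is the tempered distribution given by $$k_{y^0}(\mathbf w)=\frac{i y^0}{2\pi^2}\,\frac{m^2K_2\big(m\sqrt{|\mathbf w|^2-(y^0)^2}\big)}{|\mathbf w|^2-(y^0)^2},$$ understood as the boundary value $y^0\to y^0-i0$. That is: 1. For every $\varepsilon>0$ the function $k_{y^0-i\varepsilon}$, defined by the same formula with $y^0$ replaced by $y^0-i\varepsilon$ and the principal square root, is integrable on $\mathbb R^3$, and $\int k_{y^0-i\varepsilon}(\mathbf w)f(\mathbf w)\,d^3\mathbf w\to k_{y^0}(f)$ as $\varepsilon\downarrow0$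 for every Schwartz function $f$. 2. Away from $|\mathbf w|=|y^0|$, $k_{y^0-i\varepsilon}(\mathbf w)$ converges pointwise as $\varepsilon\downarrow 0$ to the function displayed above, and the distribution $k_{y^0}$ coincides with that function, when tested against compactly supported Schwartz functions whose support avoids $|\mathbf w|=|y^0|$. Here $\sqrt{|\mathbf w|^2-(y^0)^2}$ is the positive root for $|\mathbf w|>|y^0|$ and $i\,\mathrm{sgn}(y^0)\sqrt{(y^0)^2-|\mathbf w|^2}$ for $|\mathbf w|<|y^0|$. $K_2$ is the modified Bessel function of the second kind, $K_2(z)=\int_0^\infty e^{-z\cosh u}\cosh(2u)\,du$ for $\mathrm{Re}\,z>0$, extended continuously to the nonzero imaginary axis. 3. The convolution is the distributional one: smearing with $f$ gives $\tilde a(g)$ with $g(\mathbf z)=k_{y^0}\big(f(\,\cdot+\mathbf z-\mathbf y)\big)$, again a Schwartz function. In particular, spatial translations ($y^0=0$) act by a shift: $U((0,\mathbf y),\mathbb I)\,\tilde a(\mathbf x)\,U((0,\mathbf y),\mathbb I)^{-1}=\tilde a(\mathbf x+\mathbf y)$. -/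

import Mathlib

open MeasureTheory Filter Topology
open scoped SchwartzMap FourierTransform ComplexConjugate ENNReal

noncomputable section

section FockSpace

variable {α : Type*} [MeasurableSpace α]

/-- Relabelling the `k` arguments preserves the product measure. -/
theorem measurePreserving_relabel (μ : Measure α) [SigmaFinite μ] {k : ℕ}
    (σ : Equiv.Perm (Fin k)) :
    MeasurePreserving (fun p : Fin k → α => fun i => p (σ i))
      (Measure.pi fun _ : Fin k => μ) (Measure.pi fun _ : Fin k => μ) := by
  have h := (measurePreserving_piCongrLeft (α := fun _ : Fin k => α)
    (fun _ : Fin k => μ) σ).symm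
  have e : (fun p : Fin k → α => fun i => p (σ i)) =
      (MeasurableEquiv.piCongrLeft (fun _ : Fin k => α) σ).symm := by
    funext p i
    rfl
  rw [e]
  exact h

/-- The symmetric `k`-particle space over `L²(α, μ)`: square integrable functions of `k`
variables (for the product measure) that are symmetric almost everywhere. -/
def symmL2 (μ : Measure α) [SigmaFinite μ] (k : ℕ) :
    Submodule ℂ (Lp ℂ 2 (Measure.pi fun _ : Fin k => μ)) where
  carrier := {Ψ | ∀ σ : Equiv.Perm (Fin k),
    (fun p : Fin k → α => Ψ fun i => p (σ i)) =ᵐ[Measure.pi fun _ : Fin k => μ] Ψ}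
  add_mem' := by
    intro Ψ Φ hΨ hΦ σ
    have h := (measurePreserving_relabel μ σ).quasiMeasurePreserving.ae
      (Lp.coeFn_add Ψ Φ)
    filter_upwards [hΨ σ, hΦ σ, h, Lp.coeFn_add Ψ Φ] with p h1 h2 h3 h4
    rw [h3, h4, Pi.add_apply, Pi.add_apply, h1, h2]
  zero_mem' := by
    intro σ
    have h0 := Lp.coeFn_zero ℂ 2 (Measure.pi fun _ : Fin k => μ)
    have h := (measurePreserving_relabel μ σ).quasiMeasurePreserving.ae h0
    filter_upwards [h, h0] with p h3 h4
    rw [h3, h4, Pi.zero_apply, Pi.zero_apply]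
  smul_mem' := by
    intro c Ψ hΨ σ
    have h := (measurePreserving_relabel μ σ).quasiMeasurePreserving.ae
      (Lp.coeFn_smul c Ψ)
    filter_upwards [hΨ σ, h, Lp.coeFn_smul c Ψ] with p h1 h3 h4
    rw [h3, h4, Pi.smul_apply, Pi.smul_apply, h1]

/-- The bosonic Fock space over `L²(α, μ)`: the Hilbert direct sum of the symmetric `k`-particle
spaces, `k = 0, 1, 2, …` (for `k = 0` the space of functions on a point, i.e. `ℂ`). -/
abbrev BosonFock (μ : Measure α) [SigmaFinite μ] : Type _ :=
  lp (fun k : ℕ => symmL2 μ k) 2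

theorem measurePreserving_cons (μ : Measure α) [SigmaFinite μ] (k : ℕ) :
    MeasurePreserving (fun z : (Fin k → α) × α => (Fin.cons z.2 z.1 : Fin (k + 1) → α))
      ((Measure.pi fun _ : Fin k => μ).prod μ) (Measure.pi fun _ : Fin (k + 1) => μ) := by
  have h := ((measurePreserving_piFinSuccAbove (fun _ : Fin (k + 1) => μ) 0).symm).comp
    (Measure.measurePreserving_swap (μ := Measure.pi fun _ : Fin k => μ) (ν := μ))
  convert h using 1
  funext z
  simp [MeasurableEquiv.piFinSuccAbove, Fin.insertNthEquiv]

theorem memLp_section (μ : Measure α) [SigmaFinite μ] {k : ℕ}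
    (Ψ : Lp ℂ 2 (Measure.pi fun _ : Fin (k + 1) => μ)) :
    ∀ᵐ q ∂(Measure.pi fun _ : Fin k => μ), MemLp (fun p : α => Ψ (Fin.cons p q)) 2 μ := by
  have h := (Lp.memLp Ψ).comp_measurePreserving (measurePreserving_cons μ k)
  have h2 := (memLp_two_iff_integrable_sq_norm h.1).1 h
  filter_upwards [h2.prod_right_ae, h.1.prodMk_left] with q h3 h4
  exact (memLp_two_iff_integrable_sq_norm h4).2 h3

/-- The value of the annihilation operator at a `(k+1)`-particle wave function:
`q ↦ √(k+1) ∫ conj (f p) Ψ(p, q₁, …, q_k) dμ(p)`. -/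
def annihFun (μ : Measure α) [SigmaFinite μ] (f : Lp ℂ 2 μ) {k : ℕ}
    (Ψ : Lp ℂ 2 (Measure.pi fun _ : Fin (k + 1) => μ)) (q : Fin k → α) : ℂ :=
  (Real.sqrt (k + 1) : ℂ) * ∫ p, conj (f p) * Ψ (Fin.cons p q) ∂μ

theorem integrable_section (μ : Measure α) [SigmaFinite μ] (f : Lp ℂ 2 μ) {k : ℕ}
    (Ψ : Lp ℂ 2 (Measure.pi fun _ : Fin (k + 1) => μ)) :
    ∀ᵐ q ∂(Measure.pi fun _ : Fin k => μ),
      Integrable (fun p => conj (f p) * Ψ (Fin.cons p q)) μ := by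
  filter_upwards [memLp_section μ Ψ] with q hq
  exact (Lp.memLp f).star.integrable_mul hq

theorem annihFun_memLp (μ : Measure α) [SigmaFinite μ] (f : Lp ℂ 2 μ) {k : ℕ}
    (Ψ : Lp ℂ 2 (Measure.pi fun _ : Fin (k + 1) => μ)) :
    MemLp (annihFun μ f Ψ) 2 (Measure.pi fun _ : Fin k => μ) := by
  have h := (Lp.memLp Ψ).comp_measurePreserving (measurePreserving_cons μ k)
  have hm : AEStronglyMeasurable (fun q : Fin k → α => ∫ p, conj (f p) * Ψ (Fin.cons p q) ∂μ)
      (Measure.pi fun _ : Fin k => μ) := by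
    refine AEStronglyMeasurable.integral_prod_right'
      (f := fun z : (Fin k → α) × α => conj (f z.2) * Ψ (Fin.cons z.2 z.1)) ?_
    exact ((Lp.memLp f).star.1.comp_snd).mul h.1
  refine MemLp.const_mul ?_ _
  have h2 := ((memLp_two_iff_integrable_sq_norm h.1).1 h).integral_prod_left
  rw [memLp_two_iff_integrable_sq_norm hm]
  refine (h2.const_mul (∫ p, ‖f p‖ ^ 2 ∂μ)).mono' (hm.norm.pow 2) ?_
  filter_upwards [memLp_section μ Ψ] with q hq
  rw [Real.norm_of_nonneg (by positivity)]
  have h3 : ‖∫ p, conj (f p) * Ψ (Fin.cons p q) ∂μ‖ ≤ ∫ p, ‖f p‖ * ‖Ψ (Fin.cons p q)‖ ∂μ := by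
    refine (norm_integral_le_integral_norm _).trans (le_of_eq ?_)
    congr 1
    funext p
    rw [norm_mul, RCLike.norm_conj]
  have h4 := integral_mul_norm_le_Lp_mul_Lq (μ := μ) Real.HolderConjugate.two_two
    (f := fun p => f p) (g := fun p => Ψ (Fin.cons p q))
    (by simpa using Lp.memLp f) (by simpa using hq)
  have h5 := pow_le_pow_left₀ (norm_nonneg _) (h3.trans h4) 2
  refine h5.trans (le_of_eq ?_)
  have e1 : (0 : ℝ) ≤ ∫ p, ‖f p‖ ^ (2 : ℝ) ∂μ := integral_nonneg fun _ => by positivity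
  have e2 : (0 : ℝ) ≤ ∫ p, ‖Ψ (Fin.cons p q)‖ ^ (2 : ℝ) ∂μ :=
    integral_nonneg fun _ => by positivity
  rw [mul_pow, ← Real.sqrt_eq_rpow, ← Real.sqrt_eq_rpow, Real.sq_sqrt e1, Real.sq_sqrt e2]
  simp only [Real.rpow_two, Function.comp_apply]

theorem annihFun_symm (μ : Measure α) [SigmaFinite μ] (f : Lp ℂ 2 μ) {k : ℕ}
    (Ψ : symmL2 μ (k + 1)) (σ : Equiv.Perm (Fin k)) :
    (fun q : Fin k → α => annihFun μ f Ψ.1 fun i => q (σ i))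
      =ᵐ[Measure.pi fun _ : Fin k => μ] annihFun μ f Ψ.1 := by
  have h := (measurePreserving_cons μ k).quasiMeasurePreserving.ae
    (Ψ.2 (Equiv.Perm.decomposeFin.symm (0, σ)))
  filter_upwards [Measure.ae_ae_of_ae_prod h] with q hq
  unfold annihFun
  congr 1
  refine integral_congr_ae ?_
  filter_upwards [hq] with p hp
  rw [← hp]
  congr 3
  funext i
  refine Fin.cases ?_ (fun j => ?_) i
  · simp
  · simp

/-- The annihilation operator as a map from the `(k+1)`-particle to the `k`-particle space. -/
def annihLevel (μ : Measure α) [SigmaFinite μ] (f : Lp ℂ 2 μ) (k : ℕ) :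
    symmL2 μ (k + 1) →ₗ[ℂ] symmL2 μ k where
  toFun Ψ := ⟨(annihFun_memLp μ f Ψ.1).toLp, by
    intro σ
    have h0 := (annihFun_memLp μ f Ψ.1).coeFn_toLp
    have h := (measurePreserving_relabel μ σ).quasiMeasurePreserving.ae h0
    filter_upwards [h0, h, annihFun_symm μ f Ψ σ] with q h1 h2 h3
    rw [h1, h2, h3]⟩
  map_add' Ψ Φ := by
    apply Subtype.ext
    change (annihFun_memLp μ f (Ψ.1 + Φ.1)).toLp = (annihFun_memLp μ f Ψ.1).toLp +
      (annihFun_memLp μ f Φ.1).toLp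
    rw [← MemLp.toLp_add, MemLp.toLp_eq_toLp_iff]
    have h := (measurePreserving_cons μ k).quasiMeasurePreserving.ae (Lp.coeFn_add Ψ.1 Φ.1)
    filter_upwards [Measure.ae_ae_of_ae_prod h, integrable_section μ f Ψ.1,
      integrable_section μ f Φ.1] with q h1 h2 h3
    rw [Pi.add_apply]
    unfold annihFun
    rw [← mul_add, ← integral_add h2 h3]
    congr 1
    refine integral_congr_ae ?_
    filter_upwards [h1] with p hp
    rw [hp, Pi.add_apply, mul_add]
  map_smul' c Ψ := by
    apply Subtype.ext
    change (annihFun_memLp μ f (c • Ψ.1)).toLp = c • (annihFun_memLp μ f Ψ.1).toLp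
    rw [← MemLp.toLp_const_smul, MemLp.toLp_eq_toLp_iff]
    have h := (measurePreserving_cons μ k).quasiMeasurePreserving.ae (Lp.coeFn_smul c Ψ.1)
    filter_upwards [Measure.ae_ae_of_ae_prod h] with q h1
    rw [Pi.smul_apply]
    unfold annihFun
    rw [smul_eq_mul, mul_left_comm, ← integral_const_mul c]
    congr 1
    refine integral_congr_ae ?_
    filter_upwards [h1] with p hp
    rw [hp, Pi.smul_apply, smul_eq_mul]
    ring

/-- The annihilation operator of `f ∈ L²(α, μ)`, antilinear in `f`, as an unbounded operator on the
Fock space,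
`(a(f)Ψ)_k(q₁, …, q_k) = √(k+1) ∫ conj (f p) Ψ_{k+1}(p, q₁, …, q_k) dμ(p)`,
on its maximal domain of all `Ψ` for which the right-hand sides form a vector of the Fock space. -/
def annihilation (μ : Measure α) [SigmaFinite μ] (f : Lp ℂ 2 μ) :
    BosonFock μ →ₗ.[ℂ] BosonFock μ where
  domain :=
    { carrier := {Ψ | Memℓp (fun k : ℕ => annihLevel μ f k (Ψ (k + 1))) 2}
      add_mem' := by
        intro Ψ Φ hΨ hΦ
        have h : Memℓp ((fun k : ℕ => annihLevel μ f k (Ψ (k + 1))) +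
          fun k : ℕ => annihLevel μ f k (Φ (k + 1))) 2 := Memℓp.add hΨ hΦ
        have e : (fun k : ℕ => annihLevel μ f k ((Ψ + Φ) (k + 1))) =
            (fun k : ℕ => annihLevel μ f k (Ψ (k + 1))) +
              fun k : ℕ => annihLevel μ f k (Φ (k + 1)) := by
          funext k
          exact map_add _ _ _
        change Memℓp (fun k : ℕ => annihLevel μ f k ((Ψ + Φ) (k + 1))) 2
        rw [e]
        exact h
      zero_mem' := by
        have h : Memℓp (0 : ∀ k : ℕ, symmL2 μ k) 2 := zero_memℓp
        have e : (fun k : ℕ => annihLevel μ f k ((0 : BosonFock μ) (k + 1))) = 0 := by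
          funext k
          exact map_zero _
        change Memℓp (fun k : ℕ => annihLevel μ f k ((0 : BosonFock μ) (k + 1))) 2
        rw [e]
        exact h
      smul_mem' := by
        intro c Ψ hΨ
        have h : Memℓp (c • fun k : ℕ => annihLevel μ f k (Ψ (k + 1))) 2 :=
          Memℓp.const_smul hΨ c
        have e : (fun k : ℕ => annihLevel μ f k ((c • Ψ) (k + 1))) =
            c • fun k : ℕ => annihLevel μ f k (Ψ (k + 1)) := by
          funext k
          exact map_smul (annihLevel μ f k) c (Ψ (k + 1))
        change Memℓp (fun k : ℕ => annihLevel μ f k ((c • Ψ) (k + 1))) 2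
        rw [e]
        exact h }
  toFun :=
    { toFun := fun Ψ => ⟨fun k : ℕ => annihLevel μ f k (Ψ.1 (k + 1)), Ψ.2⟩
      map_add' := by
        intro Ψ Φ
        ext1
        funext k
        exact map_add (annihLevel μ f k) _ _
      map_smul' := by
        intro c Ψ
        ext1
        funext k
        exact map_smul (annihLevel μ f k) _ _ }

theorem phase_memLp {μ : Measure α} {θ : α → ℝ} (hθ : Measurable θ) (Ψ : Lp ℂ 2 μ) :
    MemLp (fun p => Complex.exp (Complex.I * (θ p : ℂ)) * Ψ p) 2 μ := by
  have hm : Measurable fun p => Complex.exp (Complex.I * (θ p : ℂ)) := by fun_prop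
  refine (Lp.memLp Ψ).of_le (hm.aestronglyMeasurable.mul (Lp.memLp Ψ).1) ?_
  refine Eventually.of_forall fun p => ?_
  rw [norm_mul, mul_comm Complex.I, Complex.norm_exp_ofReal_mul_I, one_mul]

/-- Multiplication by the phase `exp (i θ)` on `L²`. -/
def phaseLp (μ : Measure α) (θ : α → ℝ) (hθ : Measurable θ) : Lp ℂ 2 μ →ₗᵢ[ℂ] Lp ℂ 2 μ where
  toFun Ψ := (phase_memLp hθ Ψ).toLp
  map_add' Ψ Φ := by
    rw [← MemLp.toLp_add, MemLp.toLp_eq_toLp_iff]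
    filter_upwards [Lp.coeFn_add Ψ Φ] with p hp
    rw [hp, Pi.add_apply, Pi.add_apply, mul_add]
  map_smul' c Ψ := by
    rw [RingHom.id_apply, ← MemLp.toLp_const_smul, MemLp.toLp_eq_toLp_iff]
    filter_upwards [Lp.coeFn_smul c Ψ] with p hp
    rw [hp, Pi.smul_apply, Pi.smul_apply, smul_eq_mul, smul_eq_mul]
    ring
  norm_map' Ψ := by
    change ‖(phase_memLp hθ Ψ).toLp‖ = ‖Ψ‖
    rw [Lp.norm_toLp, Lp.norm_def]
    congr 1
    refine eLpNorm_congr_norm_ae (Eventually.of_forall fun p => ?_)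
    rw [norm_mul, mul_comm Complex.I, Complex.norm_exp_ofReal_mul_I, one_mul]

theorem phaseLp_neg (μ : Measure α) (θ η : α → ℝ) (hθ : Measurable θ) (hη : Measurable η)
    (h : ∀ p, θ p + η p = 0) (Ψ : Lp ℂ 2 μ) : phaseLp μ θ hθ (phaseLp μ η hη Ψ) = Ψ := by
  apply Lp.ext
  filter_upwards [(phase_memLp hθ (phaseLp μ η hη Ψ)).coeFn_toLp,
    (phase_memLp hη Ψ).coeFn_toLp] with p h1 h2
  change ((phase_memLp hθ (phaseLp μ η hη Ψ)).toLp : Lp ℂ 2 μ) p = Ψ p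
  rw [h1]
  change _ * ((phase_memLp hη Ψ).toLp : Lp ℂ 2 μ) p = Ψ p
  rw [h2, ← mul_assoc, ← Complex.exp_add, ← mul_add, ← Complex.ofReal_add, h]
  simp

theorem measurable_sum_phase {θ : α → ℝ} (hθ : Measurable θ) (k : ℕ) :
    Measurable fun q : Fin k → α => ∑ j, θ (q j) :=
  Finset.measurable_fun_sum _ fun j _ => hθ.comp (measurable_pi_apply j)

/-- Multiplication by `exp (i ∑ⱼ θ(qⱼ))` on the `k`-particle space. -/
def phaseLevel (μ : Measure α) [SigmaFinite μ] (θ : α → ℝ) (hθ : Measurable θ) (k : ℕ) :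
    symmL2 μ k →ₗᵢ[ℂ] symmL2 μ k where
  toFun Ψ := ⟨phaseLp _ (fun q : Fin k → α => ∑ j, θ (q j)) (measurable_sum_phase hθ k) Ψ.1, by
    intro σ
    have h0 := (phase_memLp (measurable_sum_phase hθ k) Ψ.1).coeFn_toLp
    have h := (measurePreserving_relabel μ σ).quasiMeasurePreserving.ae h0
    filter_upwards [h0, h, Ψ.2 σ] with q h1 h2 h3
    refine h2.trans (Eq.trans ?_ h1.symm)
    rw [h3, Equiv.sum_comp σ fun j => θ (q j)]⟩
  map_add' Ψ Φ := Subtype.ext (map_add (phaseLp _ _ (measurable_sum_phase hθ k)) Ψ.1 Φ.1)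
  map_smul' c Ψ := Subtype.ext (map_smul (phaseLp _ _ (measurable_sum_phase hθ k)) c Ψ.1)
  norm_map' Ψ := (phaseLp _ _ (measurable_sum_phase hθ k)).norm_map Ψ.1

theorem phaseLevel_neg (μ : Measure α) [SigmaFinite μ] (θ η : α → ℝ) (hθ : Measurable θ)
    (hη : Measurable η) (h : ∀ p, θ p + η p = 0) (k : ℕ) (Ψ : symmL2 μ k) :
    phaseLevel μ θ hθ k (phaseLevel μ η hη k Ψ) = Ψ :=
  Subtype.ext (phaseLp_neg _ _ _ _ _
    (fun q => by rw [← Finset.sum_add_distrib]; simp [h]) Ψ.1)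

theorem phaseLevel_memℓp (μ : Measure α) [SigmaFinite μ] (θ : α → ℝ) (hθ : Measurable θ)
    (Ψ : BosonFock μ) : Memℓp (fun k : ℕ => phaseLevel μ θ hθ k (Ψ k)) 2 := by
  rw [← memℓp_norm_iff]
  simp only [LinearIsometry.norm_map]
  exact memℓp_norm_iff.2 (lp.memℓp Ψ)

/-- The second quantization of the one-particle unitary "multiplication by `exp (i θ)`": on the
`k`-particle space it multiplies by `exp (i ∑ⱼ θ(qⱼ))`. -/
def fockPhase (μ : Measure α) [SigmaFinite μ] (θ : α → ℝ) (hθ : Measurable θ) :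
    BosonFock μ ≃ₗᵢ[ℂ] BosonFock μ where
  toFun Ψ := ⟨fun k : ℕ => phaseLevel μ θ hθ k (Ψ k), phaseLevel_memℓp μ θ hθ Ψ⟩
  invFun Ψ := ⟨fun k : ℕ => phaseLevel μ (fun p => -θ p) hθ.neg k (Ψ k),
    phaseLevel_memℓp μ _ hθ.neg Ψ⟩
  left_inv Ψ := by
    ext1
    funext k
    exact phaseLevel_neg μ _ _ _ _ (fun p => by simp) k (Ψ k)
  right_inv Ψ := by
    ext1
    funext k
    exact phaseLevel_neg μ _ _ _ _ (fun p => by simp) k (Ψ k)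
  map_add' Ψ Φ := by
    ext1
    funext k
    exact map_add (phaseLevel μ θ hθ k) _ _
  map_smul' c Ψ := by
    ext1
    funext k
    exact map_smul (phaseLevel μ θ hθ k) _ _
  norm_map' Ψ := by
    rw [lp.norm_eq_tsum_rpow (by norm_num), lp.norm_eq_tsum_rpow (by norm_num)]
    change (∑' k : ℕ, ‖phaseLevel μ θ hθ k (Ψ k)‖ ^ _) ^ _ = _
    simp only [LinearIsometry.norm_map]

/-- The conjugate `U A U⁻¹` of an unbounded operator `A` by a unitary `U`, with domain
`U (dom A)`. -/
def conjOp {H : Type*} [NormedAddCommGroup H] [InnerProductSpace ℂ H]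
    (U : H ≃ₗᵢ[ℂ] H) (A : H →ₗ.[ℂ] H) : H →ₗ.[ℂ] H where
  domain := A.domain.comap (U.symm.toLinearEquiv : H →ₗ[ℂ] H)
  toFun :=
    { toFun := fun Ψ => U (A ⟨U.symm Ψ.1, Ψ.2⟩)
      map_add' := by
        intro Ψ Φ
        rw [← map_add, ← LinearPMap.map_add]
        congr 2
        exact Subtype.ext (map_add U.symm Ψ.1 Φ.1)
      map_smul' := by
        intro c Ψ
        rw [RingHom.id_apply, ← map_smul, ← LinearPMap.map_smul]
        congr 2
        exact Subtype.ext (map_smul U.symm c Ψ.1) }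

end FockSpace

section FreeField

/-- Three-dimensional Euclidean space, used both for momenta `𝐩` and for positions `𝐱`. -/
abbrev Space3 : Type := EuclideanSpace ℝ (Fin 3)

/-- The relativistic energy `ω_𝐩 = √(|𝐩|² + m²)`. -/
def energy (m : ℝ) (p : Space3) : ℝ := Real.sqrt (‖p‖ ^ 2 + m ^ 2)

theorem continuous_energy (m : ℝ) : Continuous (energy m) := by
  unfold energy
  fun_prop

/-- The Lorentz invariant measure `d³𝐩 / (2 ω_𝐩)`. -/
def massShell (m : ℝ) : Measure Space3 :=
  volume.withDensity fun p => ENNReal.ofReal (1 / (2 * energy m p))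

instance (m : ℝ) : SigmaFinite (massShell m) := by
  unfold massShell
  exact SigmaFinite.withDensity_ofReal _

/-- The Fock space of the free scalar field of mass `m`. -/
abbrev ScalarFock (m : ℝ) : Type := BosonFock (massShell m)

/-- The unitary operator `U(y, 𝕀)` of the translation by `y = (t, 𝐲)`. On the `k`-particle space
it multiplies by `exp (i ∑ⱼ pⱼ·y)`, with `p·y = ω_𝐩 t - 𝐩·𝐲` the Minkowski product. -/
def translationU (m t : ℝ) (y : Space3) : ScalarFock m ≃ₗᵢ[ℂ] ScalarFock m :=
  fockPhase (massShell m) (fun p => energy m p * t - inner ℝ p y)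
    (Continuous.measurable
      (((continuous_energy m).mul continuous_const).sub (continuous_id.inner continuous_const)))

/-- The function `F(𝐩) = (2π)^{-3/2} ∫ f(𝐱) e^{i 𝐩·𝐱} d³𝐱`, for which
`∫ f(𝐱) ã(𝐱) d³𝐱 = ∫ F(𝐩) a(𝐩) d³𝐩`. -/
def smearFourier (f : 𝓢(Space3, ℂ)) (p : Space3) : ℂ :=
  (((2 * Real.pi) ^ (-(3 / 2) : ℝ) : ℝ) : ℂ) *
    ∫ x : Space3, f x * Complex.exp (Complex.I * ((inner ℝ p x : ℝ) : ℂ))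

theorem smearFourier_memLp (f : 𝓢(Space3, ℂ)) : MemLp (smearFourier f) 2 volume := by
  have hπ : (2 * Real.pi)⁻¹ ≠ 0 := by positivity
  let e : Space3 ≃L[ℝ] Space3 := ContinuousLinearEquiv.smulLeft (Units.mk0 _ hπ)
  have h := (SchwartzMap.compCLMOfContinuousLinearEquiv ℂ e (𝓕⁻ f)).memLp 2 volume
  refine MemLp.const_mul (h.ae_eq (Eventually.of_forall fun p => ?_)) _
  simp only [SchwartzMap.compCLMOfContinuousLinearEquiv_apply, Function.comp_apply]
  have he : e p = (2 * Real.pi)⁻¹ • p := rfl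
  rw [he, SchwartzMap.fourierInv_coe, Real.fourierInv_eq']
  refine integral_congr_ae (Eventually.of_forall fun x => ?_)
  simp only [smul_eq_mul]
  rw [mul_comm, inner_smul_right, real_inner_comm]
  congr 2
  rw [← mul_assoc, mul_inv_cancel₀ (by positivity), one_mul, mul_comm]

theorem smear_memLp (m : ℝ) (hm : 0 < m) (f : 𝓢(Space3, ℂ)) :
    MemLp (fun p => conj ((Real.sqrt (2 * energy m p) : ℂ) * smearFourier f p)) 2
      (massShell m) := by
  have hpos : ∀ p, 0 < energy m p := fun p => Real.sqrt_pos.2 (by positivity)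
  have hF := smearFourier_memLp f
  have hc : Continuous fun p => (Real.sqrt (2 * energy m p) : ℂ) := by
    have := continuous_energy m
    fun_prop
  have hme : AEStronglyMeasurable
      (fun p => conj ((Real.sqrt (2 * energy m p) : ℂ) * smearFourier f p)) volume :=
    (hc.aestronglyMeasurable.mul hF.1).star
  have hac : massShell m ≪ volume := withDensity_absolutelyContinuous _ _
  rw [memLp_two_iff_integrable_sq_norm (hme.mono_ac hac)]
  have hd : Measurable fun p => ENNReal.ofReal (1 / (2 * energy m p)) := by
    have := (continuous_energy m).measurable
    fun_prop
  unfold massShell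
  rw [integrable_withDensity_iff_integrable_smul' hd
    (Eventually.of_forall fun _ => ENNReal.ofReal_lt_top)]
  refine ((memLp_two_iff_integrable_sq_norm hF.1).1 hF).congr
    (Eventually.of_forall fun p => ?_)
  have h2 : (0 : ℝ) < 2 * energy m p := by linarith [hpos p]
  simp only [smul_eq_mul]
  rw [ENNReal.toReal_ofReal (by positivity), RCLike.norm_conj, norm_mul, Complex.norm_real,
    Real.norm_of_nonneg (Real.sqrt_nonneg _), mul_pow, Real.sq_sqrt h2.le]
  rw [← mul_assoc, one_div, inv_mul_cancel₀ h2.ne', one_mul]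

/-- The coordinate space annihilation operator
`ã(𝐱) = (2π)^{-3/2} ∫ e^{i 𝐩·𝐱} a(𝐩) d³𝐩`, `a(𝐩) = a_c(𝐩) / √(2 ω_𝐩)`, as an operator valued
distribution: `coordAnnihilation m hm f` is `ã(f) = ∫ f(𝐱) ã(𝐱) d³𝐱`. Since
`a_c(h) = ∫ conj (h(𝐩)) a_c(𝐩) d³𝐩 / (2 ω_𝐩)`, this is `a_c(h)` with
`h(𝐩) = conj (√(2 ω_𝐩) F(𝐩))`, `F = smearFourier f`. -/
def coordAnnihilation (m : ℝ) (hm : 0 < m) (f : 𝓢(Space3, ℂ)) :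
    ScalarFock m →ₗ.[ℂ] ScalarFock m :=
  annihilation (massShell m) (smear_memLp m hm f).toLp

end FreeField

section Kernel

/-- The integral `∫_0^∞ e^{-z cosh u} cosh (ν u) du`, which is `K_ν(z)` for `Re z > 0`. -/
def besselKIntegral (ν : ℝ) (z : ℂ) : ℂ :=
  ∫ u in Set.Ioi (0 : ℝ), Complex.exp (-z * Real.cosh u) * Real.cosh (ν * u)

/-- The modified Bessel function of the second kind `K_ν(z)` (Macdonald function) for
`Re z ≥ 0`, `z ≠ 0`: given by the integral for `Re z > 0`, and by continuity on the imaginary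
axis. -/
def besselK (ν : ℝ) (z : ℂ) : ℂ :=
  if 0 < z.re then besselKIntegral ν z
  else limUnder (𝓝[{w : ℂ | 0 < w.re}] z) (besselKIntegral ν)

/-- The time translation kernel `(i ζ / 2π²) · m² K₂(m √(|𝐰|² - ζ²)) / (|𝐰|² - ζ²)` at complex
time `ζ`, with the principal square root. -/
def timeKernel (m : ℝ) (ζ : ℂ) (w : Space3) : ℂ :=
  Complex.I * ζ / (2 * (Real.pi : ℂ) ^ 2) *
    ((m : ℂ) ^ 2 * besselK 2 (m * ((‖w‖ : ℂ) ^ 2 - ζ ^ 2) ^ (1 / 2 : ℂ)) /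
      ((‖w‖ : ℂ) ^ 2 - ζ ^ 2))

/-- `√(|𝐰|² - t²)` for real time `t`: the nonnegative root for `|𝐰| ≥ |t|`, and
`i sgn(t) √(t² - |𝐰|²)` for `|𝐰| < |t|`. -/
def lightConeRoot (t : ℝ) (w : Space3) : ℂ :=
  if |t| ≤ ‖w‖ then (Real.sqrt (‖w‖ ^ 2 - t ^ 2) : ℂ)
  else Complex.I * (SignType.sign t : ℝ) * (Real.sqrt (t ^ 2 - ‖w‖ ^ 2) : ℂ)

/-- The time translation kernel `(i t / 2π²) · m² K₂(m √(|𝐰|² - t²)) / (|𝐰|² - t²)` at real time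
`t`, away from the light cone `|𝐰| = |t|`. -/
def realTimeKernel (m t : ℝ) (w : Space3) : ℂ :=
  Complex.I * t / (2 * (Real.pi : ℂ) ^ 2) *
    ((m : ℂ) ^ 2 * besselK 2 (m * lightConeRoot t w) / ((‖w‖ : ℂ) ^ 2 - (t : ℂ) ^ 2))

/-- `g` is the test function `𝐳 ↦ ∫ f(𝐱) k(𝐱 + 𝐲 - 𝐳) d³𝐱 = k(f(· + 𝐳 - 𝐲))`. For an operator
valued distribution `T`, the distribution `𝐱 ↦ (k ∗ T)(𝐱 + 𝐲) = ∫ k(𝐱 + 𝐲 - 𝐳) T(𝐳) d³𝐳` smeared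
with `f` is `T(g)`. -/
def IsConvolutionTest (k : 𝓢'(Space3, ℂ)) (y : Space3) (f g : 𝓢(Space3, ℂ)) : Prop :=
  ∀ z : Space3, g z = k (SchwartzMap.compSubConstCLM ℂ (y - z) f)

end Kernel

end

/-! Conjugating by the second quantization of multiplication by `exp (iθ)` turns `a_c(h)` into
`a_c(exp (iθ) h)`, domains included (`conjOp_fockPhase_annihilation`). Here `θ = ωt - p·y`, and `h`
is the complex conjugate of `√(2ω) F` with `F` the Fourier transform of `f`, so `F` acquires `exp
(-iωt) exp (ip·y)`. The second factor translates `f` by `y`. The first is smooth with derivatives of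
polynomial growth, so it preserves Schwartz space and acts as convolution with its inverse Fourier
transform, which is taken as the definition of `k_t`.

It remains to compute `k_t`. At a time `ζ` with `Im ζ < 0` the function `exp (-iζω)` is integrable.
For `ζ = -is`, subordination writes `exp (-sω)` as a mixture of Gaussians in the momentum;
transforming these leaves an integral for `K₂` (`fourierInv_timePhase_neg_I`). Both sides are
holomorphic in `ζ`, so the identity theorem gives the whole lower half plane
(`fourierInv_timePhase`).

The boundary value `ζ = t - iε → t` is taken twice. In momentum space `|exp (-iζω)| ≤ 1` gives
convergence against every Schwartz function. In position space, off the light cone, the kernels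
converge pointwise because `K₂` extends continuously to the punctured imaginary axis
(`continuousOn_besselK`, by moving a contour), and they are bounded uniformly on compact sets.
Comparing the two limits identifies `k_t` with the displayed function there. -/

/-! ### Conjugation of annihilation operators by second quantized phases -/

section FockConjugation

variable {α : Type*} [MeasurableSpace α]

theorem coeFn_phaseLevel (μ : Measure α) [SigmaFinite μ] {θ : α → ℝ} (hθ : Measurable θ) (k : ℕ)
    (Ψ : symmL2 μ k) :
    (phaseLevel μ θ hθ k Ψ).1 =ᵐ[Measure.pi fun _ : Fin k => μ]
      fun q => Complex.exp (Complex.I * ((∑ j, θ (q j) : ℝ) : ℂ)) * Ψ.1 q :=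
  (phase_memLp (measurable_sum_phase hθ k) Ψ.1).coeFn_toLp

theorem coeFn_annihLevel (μ : Measure α) [SigmaFinite μ] (f : Lp ℂ 2 μ) (k : ℕ)
    (Ψ : symmL2 μ (k + 1)) :
    (annihLevel μ f k Ψ).1 =ᵐ[Measure.pi fun _ : Fin k => μ] annihFun μ f Ψ.1 :=
  (annihFun_memLp μ f Ψ.1).coeFn_toLp

/-- Conjugating the annihilation operator of `f` by the second quantized phase `exp (i θ)` gives
the annihilation operator of `exp (i θ) f`, on each particle number space. -/
theorem phaseLevel_annihLevel_phaseLevel (μ : Measure α) [SigmaFinite μ] {θ : α → ℝ}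
    (hθ : Measurable θ) {f g : Lp ℂ 2 μ}
    (hg : g =ᵐ[μ] fun p => Complex.exp (Complex.I * (θ p : ℂ)) * f p) (k : ℕ)
    (Ψ : symmL2 μ (k + 1)) :
    phaseLevel μ θ hθ k (annihLevel μ f k (phaseLevel μ (fun p => -θ p) hθ.neg (k + 1) Ψ)) =
      annihLevel μ g k Ψ := by
  apply Subtype.ext
  apply Lp.ext
  have h := (measurePreserving_cons μ k).quasiMeasurePreserving.ae
    (coeFn_phaseLevel μ (θ := fun p => -θ p) hθ.neg (k + 1) Ψ)
  filter_upwards [coeFn_phaseLevel μ hθ k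
      (annihLevel μ f k (phaseLevel μ (fun p => -θ p) hθ.neg (k + 1) Ψ)),
    coeFn_annihLevel μ f k (phaseLevel μ (fun p => -θ p) hθ.neg (k + 1) Ψ),
    coeFn_annihLevel μ g k Ψ, Measure.ae_ae_of_ae_prod h] with q h1 h2 h3 h4
  rw [h1, h2, h3]
  unfold annihFun
  rw [mul_left_comm, ← integral_const_mul]
  congr 1
  refine integral_congr_ae ?_
  filter_upwards [h4, hg] with p h5 h6
  rw [h5, h6, map_mul, ← Complex.exp_conj, map_mul, Complex.conj_I, Complex.conj_ofReal]
  -- The inner phase sees one particle more than the outer one. The phases of `q` cancel, and the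
  -- remaining `exp (-iθ(p))` is the conjugate of the phase in `g`.
  have e : ∑ j, -θ ((Fin.cons p q : Fin (k + 1) → α) j) = -θ p - ∑ j, θ (q j) := by
    rw [Fin.sum_univ_succ]
    simp [sub_eq_add_neg]
  rw [e, mul_left_comm, ← mul_assoc (Complex.exp _) (Complex.exp _), ← Complex.exp_add,
    mul_left_comm, ← mul_assoc]
  congr 2
  · rw [mul_comm]
    congr 2
    push_cast
    ring

theorem conjOp_fockPhase_annihilation (μ : Measure α) [SigmaFinite μ] {θ : α → ℝ}
    (hθ : Measurable θ) {f g : Lp ℂ 2 μ}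
    (hg : g =ᵐ[μ] fun p => Complex.exp (Complex.I * (θ p : ℂ)) * f p) :
    conjOp (fockPhase μ θ hθ) (annihilation μ f) = annihilation μ g := by
  have key := phaseLevel_annihLevel_phaseLevel μ hθ hg
  -- The maximal domains correspond because the outer phase is isometric on every level, so the two
  -- sequences have the same norms.
  have hd (Ψ : BosonFock μ) : Memℓp (fun k : ℕ => annihLevel μ f k
      (phaseLevel μ (fun p => -θ p) hθ.neg (k + 1) (Ψ (k + 1)))) 2 ↔
      Memℓp (fun k : ℕ => annihLevel μ g k (Ψ (k + 1))) 2 := by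
    rw [← memℓp_norm_iff, ← memℓp_norm_iff (f := fun k : ℕ => annihLevel μ g k (Ψ (k + 1)))]
    simp only [← key, LinearIsometry.norm_map]
  refine LinearPMap.ext (Submodule.ext hd) ?_
  intro Ψ hΨ hΨ'
  ext1
  funext k
  exact key k (Ψ (k + 1))

end FockConjugation

/-! ### The translation as a Fourier multiplier on test functions -/

section Momentum

/-- The `n`-th derivative has constant modulus `|t| ^ n`. Composed with the energy, this makes `exp
(-iωt)` a multiplier of Schwartz space. -/
theorem hasTemperateGrowth_cexp_mul_I (t : ℝ) :
    Function.HasTemperateGrowth fun u : ℝ => Complex.exp (-(Complex.I * u * t)) := by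
  have hd : ∀ n : ℕ, iteratedDeriv n (fun u : ℝ => Complex.exp (-(Complex.I * u * t))) =
      fun u : ℝ => (-(Complex.I * t)) ^ n * Complex.exp (-(Complex.I * u * t)) := by
    intro n
    induction n with
    | zero => simp
    | succ n ih =>
      rw [iteratedDeriv_succ, ih]
      funext u
      have h : HasDerivAt (fun u : ℝ => -(Complex.I * u * t)) (-(Complex.I * t)) u := by
        have := ((Complex.ofRealCLM.hasDerivAt (x := u)).const_mul Complex.I).mul_const (t : ℂ)
        simp only [Complex.ofRealCLM_apply, Complex.ofReal_one, mul_one] at this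
        exact this.neg
      rw [(h.cexp.const_mul _).deriv, pow_succ]
      ring
  have hc : ContDiff ℝ ⊤ fun u : ℝ => (u : ℂ) := Complex.ofRealCLM.contDiff
  refine ⟨(((contDiff_const.mul hc).mul contDiff_const).neg.cexp).of_le le_top,
    fun n => ⟨0, |t| ^ n, fun u => ?_⟩⟩
  rw [norm_iteratedFDeriv_eq_norm_iteratedDeriv, hd]
  have e : -(Complex.I * u * t) = ((-(u * t) : ℝ) : ℂ) * Complex.I := by push_cast; ring
  rw [norm_mul, e, Complex.norm_exp_ofReal_mul_I]
  simp

theorem energy_pos {m : ℝ} (hm : 0 < m) (p : Space3) : 0 < energy m p :=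
  Real.sqrt_pos.2 (by positivity)

theorem norm_le_energy (m : ℝ) (p : Space3) : ‖p‖ ≤ energy m p :=
  Real.le_sqrt_of_sq_le (by nlinarith [sq_nonneg m])

theorem energy_sq (m : ℝ) (p : Space3) : energy m p ^ 2 = ‖p‖ ^ 2 + m ^ 2 :=
  Real.sq_sqrt (by positivity)

/-- The function `ξ ↦ exp (-i ζ ω_{2πξ})`, the Fourier transform of the time translation kernel
in the normalization of Mathlib. -/
noncomputable def timePhase (m : ℝ) (ζ : ℂ) (ξ : Space3) : ℂ :=
  Complex.exp (-(Complex.I * energy m ((2 * Real.pi) • ξ) * ζ))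

theorem continuous_timePhase (m : ℝ) (ζ : ℂ) : Continuous (timePhase m ζ) := by
  have := continuous_energy m
  unfold timePhase
  fun_prop

theorem norm_timePhase (m : ℝ) (ζ : ℂ) (ξ : Space3) :
    ‖timePhase m ζ ξ‖ = Real.exp (energy m ((2 * Real.pi) • ξ) * ζ.im) := by
  rw [timePhase, Complex.norm_exp]
  simp

/-- Positivity of the mass keeps the root away from its singularity: `ω = m √(1 + |2πξ/m|²)` is a
Japanese bracket after scaling. -/
theorem hasTemperateGrowth_energy {m : ℝ} (hm : 0 < m) :
    Function.HasTemperateGrowth fun ξ : Space3 => energy m ((2 * Real.pi) • ξ) := by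
  have h : Function.HasTemperateGrowth
      fun ξ : Space3 => m * (1 + ‖(2 * Real.pi / m) • ξ‖ ^ 2) ^ (1 / 2 : ℝ) :=
    (Function.HasTemperateGrowth.const m).mul
      ((Function.hasTemperateGrowth_one_add_norm_sq_rpow Space3 (1 / 2)).comp
        ((2 * Real.pi / m) • ContinuousLinearMap.id ℝ Space3).hasTemperateGrowth)
  convert h using 2 with ξ
  rw [← Real.sqrt_eq_rpow, energy, Real.sqrt_eq_iff_mul_self_eq (by positivity) (by positivity)]
  rw [mul_mul_mul_comm, Real.mul_self_sqrt (by positivity), norm_smul, norm_smul,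
    Real.norm_of_nonneg (by positivity), Real.norm_of_nonneg (by positivity)]
  field_simp
  ring

theorem hasTemperateGrowth_timePhase {m : ℝ} (hm : 0 < m) (t : ℝ) :
    Function.HasTemperateGrowth (timePhase m t) :=
  (hasTemperateGrowth_cexp_mul_I t).comp (hasTemperateGrowth_energy hm)

theorem fourierInv_compSubConst (f : 𝓢(Space3, ℂ)) (a ξ : Space3) :
    𝓕⁻ (SchwartzMap.compSubConstCLM ℂ a f) ξ =
      Complex.exp (2 * Real.pi * Complex.I * (inner ℝ a ξ : ℝ)) * 𝓕⁻ f ξ := by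
  rw [SchwartzMap.fourierInv_coe, SchwartzMap.fourierInv_coe, Real.fourierInv_eq',
    Real.fourierInv_eq', ← integral_const_mul,
    ← integral_add_right_eq_self (fun v : Space3 => _) a]
  refine integral_congr_ae (Eventually.of_forall fun v => ?_)
  simp only [SchwartzMap.compSubConstCLM_apply, add_sub_cancel_right, smul_eq_mul]
  rw [← mul_assoc, ← Complex.exp_add, inner_add_left]
  congr 2
  push_cast
  ring

theorem smearFourier_eq (f : 𝓢(Space3, ℂ)) (p : Space3) :
    smearFourier f p = (((2 * Real.pi) ^ (-(3 / 2) : ℝ) : ℝ) : ℂ) *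
      𝓕⁻ f ((2 * Real.pi)⁻¹ • p) := by
  rw [smearFourier, SchwartzMap.fourierInv_coe, Real.fourierInv_eq']
  congr 1
  refine integral_congr_ae (Eventually.of_forall fun x => ?_)
  simp only [smul_eq_mul]
  rw [mul_comm, inner_smul_right, real_inner_comm]
  congr 2
  rw [← mul_assoc, mul_inv_cancel₀ (by positivity), one_mul, mul_comm]

/-- The time translation kernel `k_t` as a tempered distribution. -/
noncomputable def timeDistribution {m : ℝ} (hm : 0 < m) (t : ℝ) : 𝓢'(Space3, ℂ) :=
  𝓕⁻ ((hasTemperateGrowth_timePhase hm t).toTemperedDistribution volume)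

theorem timeDistribution_apply {m : ℝ} (hm : 0 < m) (t : ℝ) (f : 𝓢(Space3, ℂ)) :
    timeDistribution hm t f = ∫ ξ, timePhase m t ξ * 𝓕⁻ f ξ := by
  rw [timeDistribution, TemperedDistribution.fourierInv_apply]
  refine (Function.HasTemperateGrowth.toTemperedDistribution_apply volume
    (hasTemperateGrowth_timePhase hm t) (𝓕⁻ f)).trans ?_
  simp only [smul_eq_mul, mul_comm]

/-- The test function obtained from `f` by the translation by `(t, y)`. -/
noncomputable def translatedTest (m t : ℝ) (y : Space3) (f : 𝓢(Space3, ℂ)) : 𝓢(Space3, ℂ) :=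
  𝓕 (SchwartzMap.smulLeftCLM ℂ (timePhase m t) (𝓕⁻ (SchwartzMap.compSubConstCLM ℂ y f)))

/-- The character `exp (-2πi z·ξ)` of the outer Fourier transform merges with the one produced by
the shift by `y` into that of the shift by `y - z`. -/
theorem isConvolutionTest_translatedTest {m : ℝ} (hm : 0 < m) (t : ℝ) (y : Space3)
    (f : 𝓢(Space3, ℂ)) :
    IsConvolutionTest (timeDistribution hm t) y f (translatedTest m t y f) := by
  intro z
  rw [timeDistribution_apply, translatedTest, SchwartzMap.fourier_coe, Real.fourier_eq']
  refine integral_congr_ae (Eventually.of_forall fun ξ => ?_)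
  simp only [smul_eq_mul,
    SchwartzMap.smulLeftCLM_apply_apply (hasTemperateGrowth_timePhase hm t)]
  rw [fourierInv_compSubConst, fourierInv_compSubConst, mul_left_comm,
    ← mul_assoc (Complex.exp _) (Complex.exp _), ← Complex.exp_add, inner_sub_left,
    real_inner_comm z ξ]
  congr 3
  push_cast
  ring

theorem smearFourier_translatedTest {m : ℝ} (hm : 0 < m) (t : ℝ) (y : Space3)
    (f : 𝓢(Space3, ℂ)) (p : Space3) :
    smearFourier (translatedTest m t y f) p =
      Complex.exp (-(Complex.I * ((energy m p * t - inner ℝ p y : ℝ) : ℂ))) *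
        smearFourier f p := by
  rw [smearFourier_eq, smearFourier_eq, translatedTest, FourierTransform.fourierInv_fourier_eq,
    SchwartzMap.smulLeftCLM_apply_apply (hasTemperateGrowth_timePhase hm t),
    fourierInv_compSubConst, smul_eq_mul, timePhase, smul_inv_smul₀ (by positivity),
    ← mul_assoc (Complex.exp _) (Complex.exp _), ← Complex.exp_add, mul_left_comm]
  congr 2
  rw [inner_smul_right, real_inner_comm]
  have : (Real.pi : ℂ) ≠ 0 := by exact_mod_cast Real.pi_ne_zero
  push_cast
  field_simp
  ring

/-- Conjugation by a translation turns `ã(f)` into `ã(g)` when the Fourier transform of `g` is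
that of `f` multiplied by the inverse phase. -/
theorem conjOp_translationU_coordAnnihilation {m : ℝ} (hm : 0 < m) (t : ℝ) (y : Space3)
    (f g : 𝓢(Space3, ℂ))
    (h : ∀ p, smearFourier g p =
      Complex.exp (-(Complex.I * ((energy m p * t - inner ℝ p y : ℝ) : ℂ))) *
        smearFourier f p) :
    conjOp (translationU m t y) (coordAnnihilation m hm f) = coordAnnihilation m hm g := by
  refine conjOp_fockPhase_annihilation _ _ ?_
  filter_upwards [(smear_memLp m hm f).coeFn_toLp, (smear_memLp m hm g).coeFn_toLp] with p h1 h2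
  -- The one-particle function is the conjugate of the weighted transform, so the inverse phase on
  -- the transform becomes the phase itself.
  rw [h1, h2, h, map_mul, map_mul, map_mul, ← Complex.exp_conj, map_neg, map_mul, Complex.conj_I,
    Complex.conj_ofReal, Complex.conj_ofReal, neg_mul, neg_neg]
  ring

theorem conjOp_translationU_timeDistribution {m : ℝ} (hm : 0 < m) (t : ℝ) (y : Space3)
    (f : 𝓢(Space3, ℂ)) :
    conjOp (translationU m t y) (coordAnnihilation m hm f) =
      coordAnnihilation m hm (translatedTest m t y f) :=
  conjOp_translationU_coordAnnihilation hm t y f _ (smearFourier_translatedTest hm t y f)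

theorem conjOp_translationU_zero {m : ℝ} (hm : 0 < m) (y : Space3) (f : 𝓢(Space3, ℂ)) :
    conjOp (translationU m 0 y) (coordAnnihilation m hm f) =
      coordAnnihilation m hm (SchwartzMap.compSubConstCLM ℂ y f) := by
  refine conjOp_translationU_coordAnnihilation hm 0 y f _ fun p => ?_
  rw [smearFourier_eq, smearFourier_eq, fourierInv_compSubConst, mul_left_comm]
  congr 2
  rw [inner_smul_right, real_inner_comm]
  have : (Real.pi : ℂ) ≠ 0 := by exact_mod_cast Real.pi_ne_zero
  push_cast
  field_simp
  ring

end Momentum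

/-! ### `K₂` on the closed right half plane -/

section Bessel

/-- This is `v⁴/4! ≤ exp v` at `v = a exp(u)/2`, with `384 = 24 · 2⁴`. The fourth power leaves `exp
(-2u)` after the growth of `cosh 2u` is absorbed. -/
theorem exp_neg_mul_exp_le {a : ℝ} (ha : 0 < a) (u : ℝ) :
    Real.exp (-(a * Real.exp u / 2)) ≤ 384 / a ^ 4 * Real.exp (-(4 * u)) := by
  have hv : 0 < a * Real.exp u / 2 := by positivity
  have h := Real.pow_div_factorial_le_exp _ hv.le 4
  rw [Real.exp_neg, Real.exp_neg, show 4 * u = ((4 : ℕ) : ℝ) * u by norm_num, Real.exp_nat_mul]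
  have e : 384 / a ^ 4 * (Real.exp u ^ 4)⁻¹ = ((a * Real.exp u / 2) ^ 4 / 24)⁻¹ := by
    field_simp
    norm_num
  rw [e]
  refine inv_anti₀ (by positivity) ?_
  simpa [Nat.factorial] using h

theorem exp_neg_mul_cosh_le {a : ℝ} (ha : 0 < a) (u : ℝ) :
    Real.exp (-(a * Real.cosh u)) ≤ 384 / a ^ 4 * Real.exp (-(4 * u)) := by
  refine le_trans (Real.exp_le_exp.2 ?_) (exp_neg_mul_exp_le ha u)
  rw [Real.cosh_eq]
  have := mul_pos ha (Real.exp_pos (-u))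
  linarith

theorem exp_neg_mul_sinh_le {a : ℝ} (ha : 0 < a) {u : ℝ} (hu : 0 ≤ u) :
    Real.exp (-(a * Real.sinh u)) ≤ Real.exp (a / 2) * (384 / a ^ 4) * Real.exp (-(4 * u)) := by
  rw [mul_assoc]
  refine le_trans ?_ (mul_le_mul_of_nonneg_left (exp_neg_mul_exp_le ha u) (Real.exp_pos _).le)
  rw [← Real.exp_add, Real.exp_le_exp, Real.sinh_eq]
  have : a * Real.exp (-u) ≤ a * 1 :=
    mul_le_mul_of_nonneg_left (Real.exp_le_one_iff.2 (by linarith)) ha.le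
  linarith

theorem cosh_le_exp {u : ℝ} (hu : 0 ≤ u) : Real.cosh u ≤ Real.exp u := by
  rw [Real.cosh_eq]
  have := Real.exp_le_exp.2 (show -u ≤ u by linarith)
  linarith

theorem norm_besselIntegrand (z : ℂ) (u : ℝ) :
    ‖Complex.exp (-z * Real.cosh u) * Real.cosh (2 * u)‖ =
      Real.exp (-(z.re * Real.cosh u)) * Real.cosh (2 * u) := by
  rw [norm_mul, Complex.norm_exp, Complex.norm_real, Real.norm_of_nonneg (Real.cosh_pos _).le,
    Complex.re_mul_ofReal, Complex.neg_re, neg_mul]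

theorem norm_besselIntegrand_le {a : ℝ} (ha : 0 < a) {z : ℂ} (hz : a ≤ z.re) {u : ℝ}
    (hu : 0 ≤ u) :
    ‖Complex.exp (-z * Real.cosh u) * Real.cosh (2 * u)‖ ≤
      384 / a ^ 4 * Real.exp (-(2 * u)) := by
  rw [norm_besselIntegrand]
  have h1 : Real.exp (-(z.re * Real.cosh u)) ≤ Real.exp (-(a * Real.cosh u)) :=
    Real.exp_le_exp.2 (neg_le_neg (mul_le_mul_of_nonneg_right hz (Real.cosh_pos u).le))
  refine (mul_le_mul (h1.trans (exp_neg_mul_cosh_le ha u)) (cosh_le_exp (u := 2 * u) (by linarith))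
    (Real.cosh_pos _).le (by positivity)).trans (le_of_eq ?_)
  rw [mul_assoc, ← Real.exp_add]
  congr 2
  ring

theorem integrableOn_exp_neg_two : IntegrableOn (fun u : ℝ => Real.exp (-(2 * u))) (Set.Ioi 0) := by
  simpa using exp_neg_integrableOn_Ioi 0 (b := 2) two_pos

theorem integral_exp_neg_two : ∫ u in Set.Ioi (0 : ℝ), Real.exp (-(2 * u)) = 1 / 2 := by
  simpa [neg_mul] using integral_exp_mul_Ioi (a := -2) (by norm_num) 0

theorem continuous_besselIntegrand (z : ℂ) :
    Continuous fun u : ℝ => Complex.exp (-z * Real.cosh u) * Real.cosh (2 * u) := by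
  have h1 := Real.continuous_cosh
  fun_prop

theorem integrableOn_besselIntegrand {z : ℂ} (hz : 0 < z.re) :
    IntegrableOn (fun u : ℝ => Complex.exp (-z * Real.cosh u) * Real.cosh (2 * u))
      (Set.Ioi 0) := by
  refine (integrableOn_exp_neg_two.const_mul (384 / z.re ^ 4)).mono'
    (continuous_besselIntegrand z).aestronglyMeasurable ?_
  exact ae_restrict_of_forall_mem measurableSet_Ioi fun u hu =>
    norm_besselIntegrand_le hz le_rfl (le_of_lt hu)

theorem norm_besselKIntegral_le {z : ℂ} (hz : 0 < z.re) :
    ‖besselKIntegral 2 z‖ ≤ 192 / z.re ^ 4 := by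
  have h := norm_integral_le_of_norm_le (integrableOn_exp_neg_two.const_mul (384 / z.re ^ 4))
    (ae_restrict_of_forall_mem measurableSet_Ioi fun u hu =>
      norm_besselIntegrand_le hz le_rfl (le_of_lt hu))
  rw [integral_const_mul, integral_exp_neg_two] at h
  exact h.trans (le_of_eq (by ring))

theorem differentiableAt_besselKIntegral {z : ℂ} (hz : 0 < z.re) :
    DifferentiableAt ℂ (besselKIntegral 2) z := by
  -- On the ball of this radius the real part stays above `z.re / 2`. Differentiating costs a factor
  -- `cosh u ≤ exp u`, so the bound still decays like `exp (-u)`.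
  have ha : 0 < z.re / 2 := by linarith
  have hball : ∀ w ∈ Metric.ball z (z.re / 2), z.re / 2 ≤ w.re := by
    intro w hw
    have h := (Complex.abs_re_le_norm (w - z)).trans (mem_ball_iff_norm.1 hw).le
    rw [Complex.sub_re] at h
    linarith [(abs_le.1 h).1]
  have h1 : IntegrableOn (fun u : ℝ => Real.exp (-u)) (Set.Ioi 0) := by
    simpa using exp_neg_integrableOn_Ioi 0 (b := 1) one_pos
  refine (hasDerivAt_integral_of_dominated_loc_of_deriv_le
    (F' := fun w u => Complex.exp (-w * Real.cosh u) * -Real.cosh u * Real.cosh (2 * u))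
    (bound := fun u => 384 / (z.re / 2) ^ 4 * Real.exp (-u))
    (Metric.ball_mem_nhds z ha) (Eventually.of_forall fun w =>
      (continuous_besselIntegrand w).aestronglyMeasurable) (integrableOn_besselIntegrand hz)
    ?_ ?_ (h1.const_mul _) ?_).2.differentiableAt
  · refine Continuous.aestronglyMeasurable ?_
    have h1 := Real.continuous_cosh
    fun_prop
  · refine ae_restrict_of_forall_mem measurableSet_Ioi fun u hu w hw => ?_
    have hu0 : 0 ≤ u := le_of_lt hu
    rw [mul_right_comm, norm_mul, norm_neg, Complex.norm_real,
      Real.norm_of_nonneg (Real.cosh_pos _).le]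
    refine (mul_le_mul (norm_besselIntegrand_le ha (hball w hw) hu0) (cosh_le_exp hu0)
      (Real.cosh_pos _).le (by positivity)).trans (le_of_eq ?_)
    rw [mul_assoc, ← Real.exp_add]
    congr 2
    ring
  · refine Eventually.of_forall fun u w _ => ?_
    have h := ((hasDerivAt_id w).neg.mul_const (Real.cosh u : ℂ)).cexp.mul_const
      (Real.cosh (2 * u) : ℂ)
    simpa using h

/-- The continuation of `K₂` from the first quadrant to the upper half plane, obtained by moving the
contour of integration to the broken line through `0`, `-iπ/2` and `∞ - iπ/2`. -/
noncomputable def besselKUpper (z : ℂ) : ℂ :=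
  -(∫ u in Set.Ioi (0 : ℝ), Complex.exp (Complex.I * z * Real.sinh u) * Real.cosh (2 * u)) +
    Complex.I * ∫ y in (0 : ℝ)..(-(Real.pi / 2)), Complex.exp (-z * Real.cos y) * Real.cos (2 * y)

theorem norm_besselUpperIntegrand_le {a : ℝ} (ha : 0 < a) {z : ℂ} (hz : a ≤ z.im) {u : ℝ}
    (hu : 0 ≤ u) :
    ‖Complex.exp (Complex.I * z * Real.sinh u) * Real.cosh (2 * u)‖ ≤
      Real.exp (a / 2) * (384 / a ^ 4) * Real.exp (-(2 * u)) := by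
  rw [norm_mul, Complex.norm_exp, Complex.norm_real, Real.norm_of_nonneg (Real.cosh_pos _).le,
    Complex.re_mul_ofReal, Complex.I_mul_re, neg_mul]
  have h1 : Real.exp (-(z.im * Real.sinh u)) ≤ Real.exp (-(a * Real.sinh u)) :=
    Real.exp_le_exp.2 (neg_le_neg (mul_le_mul_of_nonneg_right hz (Real.sinh_nonneg_iff.2 hu)))
  refine (mul_le_mul (h1.trans (exp_neg_mul_sinh_le ha hu)) (cosh_le_exp (u := 2 * u) (by linarith))
    (Real.cosh_pos _).le (by positivity)).trans (le_of_eq ?_)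
  rw [mul_assoc, ← Real.exp_add]
  congr 2
  ring

theorem continuous_besselUpperIntegrand (z : ℂ) :
    Continuous fun u : ℝ => Complex.exp (Complex.I * z * Real.sinh u) * Real.cosh (2 * u) := by
  have h1 := Real.continuous_cosh
  have h2 := Real.continuous_sinh
  fun_prop

theorem integrableOn_besselUpperIntegrand {z : ℂ} (hz : 0 < z.im) :
    IntegrableOn (fun u : ℝ => Complex.exp (Complex.I * z * Real.sinh u) * Real.cosh (2 * u))
      (Set.Ioi 0) :=
  (integrableOn_exp_neg_two.const_mul _).mono'
    (continuous_besselUpperIntegrand z).aestronglyMeasurable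
    (ae_restrict_of_forall_mem measurableSet_Ioi fun _ hu =>
      norm_besselUpperIntegrand_le hz le_rfl (le_of_lt hu))

/-- The dominating function depends on a lower bound for `Im z` only, so the positive imaginary axis
is included. The other integral runs over a compact interval. -/
theorem continuousAt_besselKUpper {z : ℂ} (hz : 0 < z.im) : ContinuousAt besselKUpper z := by
  have ha : 0 < z.im / 2 := by linarith
  unfold besselKUpper
  refine (ContinuousAt.neg ?_).add (continuousAt_const.mul (Continuous.continuousAt ?_))
  · refine continuousAt_of_dominated (bound := fun u => Real.exp (z.im / 2 / 2) *
      (384 / (z.im / 2) ^ 4) * Real.exp (-(2 * u))) (Eventually.of_forall fun w =>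
      (continuous_besselUpperIntegrand w).aestronglyMeasurable) ?_
      (integrableOn_exp_neg_two.const_mul _) ?_
    · filter_upwards [Complex.continuous_im.continuousAt.eventually
        (lt_mem_nhds (show z.im / 2 < z.im by linarith))] with w hw
      exact ae_restrict_of_forall_mem measurableSet_Ioi fun u hu =>
        norm_besselUpperIntegrand_le ha (le_of_lt hw) (le_of_lt hu)
    · exact Eventually.of_forall fun u => by fun_prop
  · refine intervalIntegral.continuous_parametric_intervalIntegral_of_continuous' ?_ _ _
    fun_prop

theorem norm_cosh_le (w : ℂ) : ‖Complex.cosh w‖ ≤ Real.cosh w.re := by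
  rw [Complex.cosh, Real.cosh_eq, norm_div, Complex.norm_two]
  refine div_le_div_of_nonneg_right ((norm_add_le _ _).trans (le_of_eq ?_)) two_pos.le
  rw [Complex.norm_exp, Complex.norm_exp, Complex.neg_re]

/-- With `cos y ≥ 0 ≥ sin y`, the real part of `z cosh (T + iy)` is at least `a sinh T (cos y - sin
y) ≥ a sinh T`. Hence the far vertical side of the contour contributes nothing in the limit. -/
theorem norm_besselIntegrand_side_le {z : ℂ} {a : ℝ} (ha : 0 < a) (hr : a ≤ z.re) (hi : a ≤ z.im)
    {T : ℝ} (hT : 0 ≤ T) {y : ℝ} (hy : y ∈ Set.Icc (-(Real.pi / 2)) 0) :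
    ‖Complex.exp (-z * Complex.cosh (T + y * Complex.I)) *
        Complex.cosh (2 * (T + y * Complex.I))‖ ≤
      Real.exp (a / 2) * (384 / a ^ 4) * Real.exp (-(2 * T)) := by
  have h1 : Complex.cosh (T + y * Complex.I) =
      ((Real.cosh T * Real.cos y : ℝ) : ℂ) + ((Real.sinh T * Real.sin y : ℝ) : ℂ) * Complex.I := by
    rw [Complex.cosh_add, Complex.cosh_mul_I, Complex.sinh_mul_I]
    push_cast
    ring
  have hc : 0 ≤ Real.cos y :=
    Real.cos_nonneg_of_mem_Icc ⟨hy.1, hy.2.trans (by positivity)⟩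
  have hs : Real.sin y ≤ 0 :=
    Real.sin_nonpos_of_nonpos_of_neg_pi_le hy.2 (by linarith [hy.1, Real.pi_pos])
  have hcs : 1 ≤ Real.cos y - Real.sin y := by
    nlinarith [Real.sin_sq_add_cos_sq y, mul_nonneg hc (neg_nonneg.2 hs)]
  have hsT : 0 ≤ Real.sinh T := Real.sinh_nonneg_iff.2 hT
  have hre : (-z * Complex.cosh (T + y * Complex.I)).re ≤ -(a * Real.sinh T) := by
    rw [h1, Complex.mul_re]
    simp only [Complex.neg_re, Complex.neg_im, Complex.add_re, Complex.add_im, Complex.ofReal_re,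
      Complex.ofReal_im, Complex.re_ofReal_mul, Complex.im_ofReal_mul, Complex.I_re, Complex.I_im]
    have e1 : a * Real.sinh T * Real.cos y ≤ z.re * (Real.cosh T * Real.cos y) := by
      rw [mul_assoc]
      exact mul_le_mul hr (mul_le_mul_of_nonneg_right (Real.sinh_lt_cosh T).le hc)
        (by positivity) (by linarith)
    have e2 : a * (Real.sinh T * -Real.sin y) ≤ z.im * (Real.sinh T * -Real.sin y) :=
      mul_le_mul_of_nonneg_right hi (mul_nonneg hsT (by linarith))
    have e3 : a * Real.sinh T * 1 ≤ a * Real.sinh T * (Real.cos y - Real.sin y) :=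
      mul_le_mul_of_nonneg_left hcs (by positivity)
    nlinarith
  have h2 : ‖Complex.cosh (2 * (T + y * Complex.I))‖ ≤ Real.exp (2 * T) := by
    refine (norm_cosh_le _).trans ?_
    have : (2 * ((T : ℂ) + y * Complex.I)).re = 2 * T := by simp
    rw [this]
    exact cosh_le_exp (by linarith)
  rw [norm_mul, Complex.norm_exp]
  refine (mul_le_mul ((Real.exp_le_exp.2 hre).trans (exp_neg_mul_sinh_le ha hT)) h2
    (norm_nonneg _) (by positivity)).trans (le_of_eq ?_)
  rw [mul_assoc, ← Real.exp_add]
  congr 2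
  ring

/-- Cauchy's theorem on the rectangle with corners `0` and `T - iπ/2`, then `T → ∞`. Since `cosh (x
- iπ/2) = -i sinh x`, the decay on the lower side is governed by `Im z` instead of `Re z`. -/
theorem besselKIntegral_eq_upper {z : ℂ} (hr : 0 < z.re) (hi : 0 < z.im) :
    besselKIntegral 2 z = besselKUpper z := by
  let f : ℂ → ℂ := fun w => Complex.exp (-z * Complex.cosh w) * Complex.cosh (2 * w)
  have hf : Differentiable ℂ f := by
    have := Complex.differentiable_cosh
    fun_prop
  have hrect (T : ℝ) := Complex.integral_boundary_rect_eq_zero_of_differentiableOn f 0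
    (T - (Real.pi / 2 : ℝ) * Complex.I) hf.differentiableOn
  simp only [Complex.zero_re, Complex.zero_im, Complex.sub_re, Complex.sub_im, Complex.ofReal_re,
    Complex.ofReal_im, Complex.re_ofReal_mul, Complex.im_ofReal_mul, Complex.I_re, Complex.I_im,
    mul_zero, mul_one, sub_zero, zero_sub, Complex.ofReal_zero, zero_mul, add_zero, zero_add]
    at hrect
  have e1 : ∀ x : ℝ, f x = Complex.exp (-z * Real.cosh x) * Real.cosh (2 * x) := fun x => by
    simp [f]
  have e2 : ∀ x : ℝ, f (x + ((-(Real.pi / 2) : ℝ) : ℂ) * Complex.I) =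
      -(Complex.exp (Complex.I * z * Real.sinh x) * Real.cosh (2 * x)) := fun x => by
    have c1 : Complex.cosh (x + ((-(Real.pi / 2) : ℝ) : ℂ) * Complex.I) =
        -(Real.sinh x * Complex.I) := by
      rw [Complex.cosh_add, Complex.cosh_mul_I, Complex.sinh_mul_I, ← Complex.ofReal_cos,
        ← Complex.ofReal_sin]
      simp
    have c2 : Complex.cosh (2 * (x + ((-(Real.pi / 2) : ℝ) : ℂ) * Complex.I)) =
        -Real.cosh (2 * x) := by
      rw [Complex.cosh_two_mul, c1, Complex.sinh_add, Complex.cosh_mul_I, Complex.sinh_mul_I,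
        ← Complex.ofReal_cos, ← Complex.ofReal_sin, Real.cosh_two_mul]
      simp [mul_pow]
    simp only [f]
    rw [c1, c2, mul_neg]
    congr 3
    ring
  have e3 : ∀ y : ℝ, f (y * Complex.I) = Complex.exp (-z * Real.cos y) * Real.cos (2 * y) :=
    fun y => by
      simp only [f]
      rw [← mul_assoc, Complex.cosh_mul_I, Complex.cosh_mul_I]
      push_cast
      rfl
  have t1 := intervalIntegral_tendsto_integral_Ioi 0 (integrableOn_besselIntegrand hr) tendsto_id
  have t2 := (intervalIntegral_tendsto_integral_Ioi 0 (integrableOn_besselUpperIntegrand hi)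
    tendsto_id).neg
  have t3 : Tendsto (fun T : ℝ => ∫ y in (0 : ℝ)..(-(Real.pi / 2)), f (T + y * Complex.I)) atTop
      (𝓝 0) := by
    have ha : 0 < min z.re z.im := lt_min hr hi
    have hlim : Tendsto (fun T : ℝ => Real.exp (min z.re z.im / 2) * (384 / min z.re z.im ^ 4) *
        Real.exp (-(2 * T)) * |(-(Real.pi / 2)) - 0|) atTop (𝓝 0) := by
      have : Tendsto (fun T : ℝ => Real.exp (-(2 * T))) atTop (𝓝 0) :=
        Real.tendsto_exp_neg_atTop_nhds_zero.comp (tendsto_id.const_mul_atTop two_pos)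
      simpa using (this.const_mul (Real.exp (min z.re z.im / 2) *
        (384 / min z.re z.im ^ 4))).mul_const (|(-(Real.pi / 2)) - 0|)
    refine squeeze_zero_norm' ?_ hlim
    filter_upwards [eventually_ge_atTop 0] with T hT
    refine intervalIntegral.norm_integral_le_of_norm_le_const fun y hy => ?_
    rw [Set.uIoc_of_ge (by linarith [Real.pi_pos])] at hy
    exact norm_besselIntegrand_side_le ha (min_le_left _ _) (min_le_right _ _) hT
      ⟨hy.1.le, hy.2⟩
  have hlim := ((t1.sub t2).add (t3.const_smul Complex.I)).sub_const
    (Complex.I • ∫ y in (0 : ℝ)..(-(Real.pi / 2)), f (y * Complex.I))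
  have h0 := tendsto_nhds_unique (hlim.congr fun T => by
    simp only [id]
    rw [← intervalIntegral.integral_neg]
    simp only [← e1, ← e2]
    exact hrect T) tendsto_const_nhds
  simp only [e3, smul_eq_mul] at h0
  rw [besselKIntegral, besselKUpper, ← sub_eq_zero, ← h0]
  ring

theorem besselKIntegral_conj (z : ℂ) :
    besselKIntegral 2 (conj z) = conj (besselKIntegral 2 z) := by
  rw [besselKIntegral, besselKIntegral, ← integral_conj]
  refine integral_congr_ae (Eventually.of_forall fun u => ?_)
  simp only [map_mul, ← Complex.exp_conj, map_neg, Complex.conj_ofReal]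

theorem nhdsWithin_re_pos_neBot {z : ℂ} (hz : 0 ≤ z.re) : (𝓝[{w : ℂ | 0 < w.re}] z).NeBot := by
  rw [← mem_closure_iff_nhdsWithin_neBot, Complex.closure_setOfPred_lt_re]
  exact hz

/-- On the imaginary axis `besselK` is a `limUnder`, which is meaningful only if the limit exists; a
local continuous extension `H` provides it. -/
theorem besselK_eq_of_eventuallyEq {z : ℂ} (hz : 0 ≤ z.re) {H : ℂ → ℂ} (hH : ContinuousAt H z)
    (h : ∀ᶠ w in 𝓝 z, 0 < w.re → besselKIntegral 2 w = H w) : besselK 2 z = H z := by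
  by_cases h0 : 0 < z.re
  · rw [besselK, if_pos h0]
    exact h.self_of_nhds h0
  · rw [besselK, if_neg h0]
    have := nhdsWithin_re_pos_neBot hz
    refine Tendsto.limUnder_eq ((hH.mono_left nhdsWithin_le_nhds).congr' ?_)
    filter_upwards [nhdsWithin_le_nhds h, self_mem_nhdsWithin] with w h1 h2 using (h1 h2).symm

/-- `K₂` is continuous on the closed right half plane without the origin. -/
theorem continuousOn_besselK : ContinuousOn (besselK 2) {z : ℂ | 0 ≤ z.re ∧ z ≠ 0} := by
  -- The open upper, lower and right half planes cover the set, and each carries a continuous model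
  -- of `K₂`. The lower one is the reflection of the upper one.
  suffices h : ∀ (U : Set ℂ) (H : ℂ → ℂ), IsOpen U → (∀ z ∈ U, ContinuousAt H z) →
      (∀ z ∈ U, 0 < z.re → besselKIntegral 2 z = H z) → ∀ z ∈ U,
        ContinuousWithinAt (besselK 2) {z : ℂ | 0 ≤ z.re ∧ z ≠ 0} z by
    rintro z ⟨hz, hz0⟩
    rcases lt_trichotomy z.im 0 with hi | hi | hi
    · refine h {z | z.im < 0} (fun z => conj (besselKUpper (conj z)))
        (isOpen_lt Complex.continuous_im continuous_const) ?_ ?_ z hi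
      · intro z hz
        have h1 : ContinuousAt besselKUpper (conj z) :=
          continuousAt_besselKUpper (by simpa using hz)
        exact Complex.continuous_conj.continuousAt.comp
          (ContinuousAt.comp (f := fun z : ℂ => conj z) h1 Complex.continuous_conj.continuousAt)
      · intro z hz hr
        rw [← besselKIntegral_eq_upper (by simpa using hr) (by simpa using hz),
          besselKIntegral_conj, Complex.conj_conj]
    · have hr : 0 < z.re := lt_of_le_of_ne hz fun h => hz0 (Complex.ext h.symm hi)
      exact h {z | 0 < z.re} (besselKIntegral 2) (isOpen_lt continuous_const Complex.continuous_re)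
        (fun z hz => (differentiableAt_besselKIntegral hz).continuousAt) (fun _ _ _ => rfl) z hr
    · exact h {z | 0 < z.im} besselKUpper (isOpen_lt continuous_const Complex.continuous_im)
        (fun z hz => continuousAt_besselKUpper hz)
        (fun z hz hr => besselKIntegral_eq_upper hr hz) z hi
  intro U H hU hH hKH z hz
  have heq : ∀ w ∈ U, 0 ≤ w.re → besselK 2 w = H w := fun w hw hr =>
    besselK_eq_of_eventuallyEq hr (hH w hw)
      (by filter_upwards [hU.mem_nhds hw] with v hv using hKH v hv)
  by_cases hr : 0 ≤ z.re
  · refine (hH z hz).continuousWithinAt.congr_of_eventuallyEq ?_ (heq z hz hr)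
    filter_upwards [nhdsWithin_le_nhds (hU.mem_nhds hz), self_mem_nhdsWithin] with w h1 h2
    exact heq w h1 h2.1
  · refine continuousWithinAt_of_notMem_closure fun hc => hr ?_
    exact closure_minimal (fun w hw => hw.1) (isClosed_le continuous_const Complex.continuous_re) hc

end Bessel

/-! ### Subordination and real integrals for `K₂` -/

section Subordination

theorem integrable_cosh_mul_exp_neg_sinh_sq {c : ℝ} (hc : 0 < c) :
    Integrable (fun x : ℝ => Real.cosh x * Real.exp (-c * Real.sinh x ^ 2)) ∧
      ∫ x : ℝ, Real.cosh x * Real.exp (-c * Real.sinh x ^ 2) = Real.sqrt (Real.pi / c) := by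
  have hd : ∀ x ∈ Set.univ, HasDerivWithinAt Real.sinh (Real.cosh x) Set.univ x :=
    fun x _ => (Real.hasDerivAt_sinh x).hasDerivWithinAt
  have hi : Set.InjOn Real.sinh Set.univ := Real.sinh_injective.injOn
  have himg : Real.sinh '' Set.univ = Set.univ := by
    rw [Set.image_univ, Real.sinh_surjective.range_eq]
  have h1 := integrableOn_image_iff_integrableOn_abs_deriv_smul MeasurableSet.univ hd hi
    fun x => Real.exp (-c * x ^ 2)
  have h2 := integral_image_eq_integral_abs_deriv_smul MeasurableSet.univ hd hi
    fun x => Real.exp (-c * x ^ 2)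
  simp only [himg, integrableOn_univ, Measure.restrict_univ, smul_eq_mul, abs_of_pos (Real.cosh_pos _)]
    at h1 h2
  exact ⟨h1.1 (integrable_exp_neg_mul_sq hc), by rw [← h2, integral_gaussian]⟩

/-- An exponential weight against an even function can be replaced by a hyperbolic cosine. -/
theorem integral_exp_mul_even {a : ℝ} {g : ℝ → ℝ} (hg : ∀ x, g (-x) = g x) (hg0 : ∀ x, 0 ≤ g x)
    (hgc : Continuous g) (hi : Integrable fun x => Real.cosh (a * x) * g x) :
    Integrable (fun x => Real.exp (a * x) * g x) ∧
      ∫ x, Real.exp (a * x) * g x = ∫ x, Real.cosh (a * x) * g x := by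
  have h1 : Integrable (fun x => Real.exp (a * x) * g x) := by
    refine (hi.const_mul 2).mono' (by fun_prop) (Eventually.of_forall fun x => ?_)
    rw [Real.norm_of_nonneg (mul_nonneg (Real.exp_pos _).le (hg0 x)), ← mul_assoc]
    refine mul_le_mul_of_nonneg_right ?_ (hg0 x)
    rw [Real.cosh_eq]
    linarith [Real.exp_pos (-(a * x))]
  refine ⟨h1, ?_⟩
  have h2 := integral_neg_eq_self (fun x => Real.exp (a * x) * g x) volume
  have h3 : ∫ x, Real.cosh (a * x) * g x =
      ∫ x, (1 / 2 * (Real.exp (a * x) * g x) + 1 / 2 * (Real.exp (a * -x) * g (-x))) := by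
    refine integral_congr_ae (Eventually.of_forall fun x => ?_)
    simp only [hg, mul_neg, Real.cosh_eq]
    ring
  rw [h3, integral_add (h1.const_mul _) (h1.comp_neg.const_mul _), integral_const_mul,
    integral_const_mul, h2]
  ring

/-- The elementary case of order `1/2`: only the even part `cosh (v/2)` counts, and `cosh v = 1 + 2
sinh² (v/2)` makes the integral Gaussian in `sinh (v/2)`. -/
theorem integral_exp_neg_half_mul_exp_neg_cosh {c : ℝ} (hc : 0 < c) :
    Integrable (fun v : ℝ => Real.exp (-(1 / 2) * v) * Real.exp (-(c * Real.cosh v))) ∧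
      ∫ v : ℝ, Real.exp (-(1 / 2) * v) * Real.exp (-(c * Real.cosh v)) =
        2 * Real.exp (-c) * Real.sqrt (Real.pi / (2 * c)) := by
  obtain ⟨h1, h2⟩ := integrable_cosh_mul_exp_neg_sinh_sq (c := 2 * c) (by positivity)
  have e : (fun v : ℝ => Real.cosh (-(1 / 2) * v) * Real.exp (-(c * Real.cosh v))) =
      fun v => Real.exp (-c) * (Real.cosh ((1 / 2) * v) *
        Real.exp (-(2 * c) * Real.sinh ((1 / 2) * v) ^ 2)) := by
    funext v
    rw [neg_mul, Real.cosh_neg, mul_left_comm, ← Real.exp_add]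
    congr 2
    have : Real.cosh v = Real.cosh (2 * ((1 / 2) * v)) := by congr 1; ring
    rw [this, Real.cosh_two_mul, Real.cosh_sq]
    ring
  have hc := Real.continuous_cosh
  obtain ⟨h3, h4⟩ := integral_exp_mul_even (a := -(1 / 2))
    (g := fun v => Real.exp (-(c * Real.cosh v))) (by simp) (fun x => (Real.exp_pos _).le)
    (by fun_prop) (by
      rw [e]
      exact (h1.comp_mul_left' (by norm_num)).const_mul _)
  refine ⟨h3, h4.trans ?_⟩
  rw [e, integral_const_mul, Measure.integral_comp_mul_left
    (fun x => Real.cosh x * Real.exp (-(2 * c) * Real.sinh x ^ 2)) (1 / 2 : ℝ), h2]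
  norm_num
  ring

theorem integral_exp_neg_two_mul_exp_neg_cosh {c : ℝ} (hc : 0 < c) :
    ((∫ v : ℝ, Real.exp (-2 * v) * Real.exp (-(c * Real.cosh v)) : ℝ) : ℂ) =
      2 * besselKIntegral 2 c := by
  let f : ℝ → ℝ := fun v => Real.cosh (-2 * v) * Real.exp (-(c * Real.cosh v))
  have hf : ∀ v, f |v| = f v := fun v => by
    rcases abs_choice v with h | h <;> simp [f, h]
  have hfc : ∀ v : ℝ, Complex.exp (-(c : ℂ) * Real.cosh v) * Real.cosh (2 * v) = (f v : ℂ) := by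
    intro v
    simp only [f]
    rw [neg_mul 2 v, Real.cosh_neg]
    push_cast
    ring_nf
  have hfi : IntegrableOn f (Set.Ioi 0) := by
    have h := integrableOn_besselIntegrand (z := c) (by simpa using hc)
    simp only [hfc] at h
    exact h.re
  have hfi' : Integrable f := by
    rw [← integrableOn_univ, ← Set.Iic_union_Ioi (a := (0 : ℝ)), integrableOn_union]
    refine ⟨?_, hfi⟩
    have hneg : MeasurableEmbedding fun x : ℝ => -x := (Homeomorph.neg ℝ).measurableEmbedding
    rw [← Measure.map_neg_eq_self (volume : Measure ℝ), hneg.integrableOn_map_iff]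
    have e : f ∘ (fun x : ℝ => -x) = f := by
      funext v
      simp [f]
    rw [e]
    simpa [integrableOn_Ici_iff_integrableOn_Ioi] using hfi
  have hcosh := Real.continuous_cosh
  obtain ⟨-, h4⟩ := integral_exp_mul_even (a := -2)
    (g := fun v => Real.exp (-(c * Real.cosh v))) (by simp) (fun x => (Real.exp_pos _).le)
    (by fun_prop) hfi'
  have h5 := integral_comp_abs (f := f)
  simp only [hf] at h5
  rw [h4, besselKIntegral]
  simp only [hfc]
  rw [integral_complex_ofReal]
  change ((∫ x, f x : ℝ) : ℂ) = _
  rw [h5]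
  push_cast
  rfl

/-- Shifting the variable of integration so that the two exponentials are balanced. -/
theorem exp_balanced_shift {a b : ℝ} (ha : 0 < a) (hb : 0 < b) (k v : ℝ) :
    Real.exp (k * (v + Real.log (a / (2 * b))) - a ^ 2 * Real.exp (-(v + Real.log (a / (2 * b)))) / 4
      - b ^ 2 * Real.exp (v + Real.log (a / (2 * b)))) =
    (a / (2 * b)) ^ k * (Real.exp (k * v) * Real.exp (-(a * b * Real.cosh v))) := by
  have hp : 0 < a / (2 * b) := by positivity
  rw [neg_add, Real.exp_add v, Real.exp_add (-v), Real.exp_neg (Real.log _), Real.exp_log hp,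
    Real.rpow_def_of_pos hp, ← Real.exp_add, ← Real.exp_add, Real.cosh_eq]
  congr 1
  field_simp
  ring

/-- The subordination formula for `exp (-a b)`. -/
theorem integral_subordination {a b : ℝ} (ha : 0 < a) (hb : 0 < b) :
    Integrable (fun u : ℝ => Real.exp (-(1 / 2) * u - a ^ 2 * Real.exp (-u) / 4
      - b ^ 2 * Real.exp u)) ∧
    ∫ u : ℝ, Real.exp (-(1 / 2) * u - a ^ 2 * Real.exp (-u) / 4 - b ^ 2 * Real.exp u) =
      2 * Real.sqrt Real.pi / a * Real.exp (-(a * b)) := by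
  obtain ⟨h1, h2⟩ := integral_exp_neg_half_mul_exp_neg_cosh (mul_pos ha hb)
  have e := exp_balanced_shift ha hb (-(1 / 2))
  refine ⟨?_, ?_⟩
  · have h3 := h1.const_mul ((a / (2 * b)) ^ (-(1 / 2) : ℝ))
    simp only [← e] at h3
    simpa using h3.comp_add_right (-Real.log (a / (2 * b)))
  · rw [← integral_add_right_eq_self _ (Real.log (a / (2 * b)))]
    simp only [e]
    rw [integral_const_mul, h2, Real.rpow_neg (by positivity), ← Real.sqrt_eq_rpow,
      -- The root of the factor `a / (2b)` cancels the prefactor `(a / (2b)) ^ (-1/2)` left by the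
      -- shift.
      show Real.pi / (2 * (a * b)) = Real.pi / a ^ 2 * (a / (2 * b)) by field_simp,
      Real.sqrt_mul (by positivity), Real.sqrt_div Real.pi_pos.le, Real.sqrt_sq ha.le]
    have : Real.sqrt (a / (2 * b)) ≠ 0 := (Real.sqrt_pos.2 (by positivity)).ne'
    field_simp

/-- The balancing shift with weight `-2` contributes `(a / (2b))⁻² = 4b²/a²`, and the integral over
the whole line is twice `K₂`. -/
theorem integral_exp_eq_besselK {a b : ℝ} (ha : 0 < a) (hb : 0 < b) :
    ((∫ u : ℝ, Real.exp (-2 * u - a ^ 2 * Real.exp (-u) / 4 - b ^ 2 * Real.exp u) : ℝ) : ℂ) =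
      8 * b ^ 2 / a ^ 2 * besselKIntegral 2 ((a * b : ℝ) : ℂ) := by
  rw [← integral_add_right_eq_self _ (Real.log (a / (2 * b)))]
  simp only [exp_balanced_shift ha hb (-2)]
  rw [integral_const_mul, Complex.ofReal_mul, integral_exp_neg_two_mul_exp_neg_cosh
    (mul_pos ha hb), Real.rpow_neg (by positivity), Real.rpow_two]
  push_cast
  have h1 : (a : ℂ) ≠ 0 := by exact_mod_cast ha.ne'
  have h2 : (b : ℂ) ≠ 0 := by exact_mod_cast hb.ne'
  field_simp
  ring

end Subordination

/-! ### The kernel at imaginary time -/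

section KernelFourier

theorem integrable_one_add_norm_four : Integrable fun ξ : Space3 => (1 + ‖ξ‖) ^ (-4 : ℝ) :=
  integrable_one_add_norm (by simp; norm_num)

theorem norm_le_energy_two_pi (m : ℝ) (ξ : Space3) : ‖ξ‖ ≤ energy m ((2 * Real.pi) • ξ) := by
  refine le_trans ?_ (norm_le_energy m _)
  rw [norm_smul, Real.norm_of_nonneg (by positivity)]
  have := Real.two_le_pi
  exact le_mul_of_one_le_left (norm_nonneg _) (by linarith)

/-- Since `ω ≥ ‖ξ‖`, the bound `v⁴/4! ≤ exp v` at `v = s(1 + ‖ξ‖)` gives decay of order `4`, more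
than the dimension `3`. -/
theorem integrable_exp_neg_energy (m : ℝ) {s : ℝ} (hs : 0 < s) :
    Integrable fun ξ : Space3 => Real.exp (-(energy m ((2 * Real.pi) • ξ) * s)) := by
  have hc := continuous_energy m
  refine (integrable_one_add_norm_four.const_mul (Real.exp s * (24 / s ^ 4))).mono'
    (by fun_prop) (Eventually.of_forall fun ξ => ?_)
  rw [Real.norm_of_nonneg (Real.exp_pos _).le]
  have h1 : Real.exp (-(energy m ((2 * Real.pi) • ξ) * s)) ≤
      Real.exp s * Real.exp (-((1 + ‖ξ‖) * s)) := by
    rw [← Real.exp_add, Real.exp_le_exp]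
    nlinarith [norm_le_energy_two_pi m ξ]
  have hv : 0 < (1 + ‖ξ‖) * s := by positivity
  have h2 := Real.pow_div_factorial_le_exp _ hv.le 4
  rw [mul_assoc]
  refine h1.trans (mul_le_mul_of_nonneg_left ?_ (Real.exp_pos _).le)
  have e : 24 / s ^ 4 * (1 + ‖ξ‖) ^ (-4 : ℝ) = (((1 + ‖ξ‖) * s) ^ 4 / 24)⁻¹ := by
    rw [Real.rpow_neg (by positivity), show (4 : ℝ) = ((4 : ℕ) : ℝ) by norm_num, Real.rpow_natCast]
    field_simp
  rw [e, Real.exp_neg]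
  exact inv_anti₀ (by positivity) (by simpa [Nat.factorial] using h2)

theorem integrable_timePhase (m : ℝ) {ζ : ℂ} (hζ : ζ.im < 0) : Integrable (timePhase m ζ) := by
  refine (integrable_exp_neg_energy m (neg_pos.2 hζ)).mono'
    (continuous_timePhase m ζ).aestronglyMeasurable (Eventually.of_forall fun ξ => ?_)
  rw [norm_timePhase]
  simp

theorem fourierInv_exp_neg_mul_sq {b : ℝ} (hb : 0 < b) (w : Space3) :
    ∫ ξ : Space3, Complex.exp (2 * Real.pi * Complex.I * (inner ℝ ξ w : ℝ)) *
      ((Real.exp (-(b * ‖(2 * Real.pi) • ξ‖ ^ 2)) : ℝ) : ℂ) =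
      (((4 * Real.pi * b) ^ (-(3 / 2) : ℝ) * Real.exp (-(‖w‖ ^ 2 * b⁻¹ / 4)) : ℝ) : ℂ) := by
  have hb' : 0 < (((4 * Real.pi ^ 2 * b : ℝ) : ℂ)).re := by
    rw [Complex.ofReal_re]
    positivity
  have h := GaussianFourier.integral_cexp_neg_mul_sq_norm_add hb' (2 * Real.pi * Complex.I) w
  rw [finrank_euclideanSpace_fin] at h
  refine Eq.trans (integral_congr_ae (Eventually.of_forall fun ξ => ?_)) (h.trans ?_)
  · simp only
    rw [norm_smul, Real.norm_of_nonneg (by positivity), Complex.ofReal_exp, ← Complex.exp_add,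
      real_inner_comm]
    congr 1
    push_cast
    ring
  · rw [Complex.ofReal_mul ((4 * Real.pi * b) ^ (-(3 / 2) : ℝ)), Complex.ofReal_exp]
    have hπ : (Real.pi : ℂ) ≠ 0 := by exact_mod_cast Real.pi_ne_zero
    have hbc : (b : ℂ) ≠ 0 := by exact_mod_cast hb.ne'
    congr 1
    · rw [Real.rpow_neg (by positivity), ← Real.inv_rpow (by positivity),
        Complex.ofReal_cpow (by positivity)]
      push_cast
      congr 1
      field_simp
    · congr 1
      push_cast
      rw [mul_pow, mul_pow, Complex.I_sq]
      field_simp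
      ring

/-- Subordination makes the energy enter through `ω² = |p|² + m²`, so the momentum integral is
Gaussian. Its factor `exp (-3u/2)` joins `exp (-u/2)` to give `exp (-2u)`, whence the order `2`; its
exponent adds `‖w‖²` to `s²`. -/
theorem fourierInv_timePhase_neg_I {m : ℝ} (hm : 0 < m) {s : ℝ} (hs : 0 < s) (w : Space3) :
    𝓕⁻ (timePhase m (-(Complex.I * s))) w = timeKernel m (-(Complex.I * s)) w := by
  let K : Space3 → ℝ → ℂ := fun ξ u =>
    Complex.exp (2 * Real.pi * Complex.I * (inner ℝ ξ w : ℝ)) *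
      ((Real.exp (-(1 / 2) * u - s ^ 2 * Real.exp (-u) / 4 -
        energy m ((2 * Real.pi) • ξ) ^ 2 * Real.exp u) : ℝ) : ℂ)
  have hKn : ∀ ξ u, ‖K ξ u‖ = Real.exp (-(1 / 2) * u - s ^ 2 * Real.exp (-u) / 4 -
      energy m ((2 * Real.pi) • ξ) ^ 2 * Real.exp u) := fun ξ u => by
    have e : 2 * Real.pi * Complex.I * (inner ℝ ξ w : ℝ) =
        ((2 * Real.pi * inner ℝ ξ w : ℝ) : ℂ) * Complex.I := by push_cast; ring
    simp only [K]
    rw [norm_mul, e, Complex.norm_exp_ofReal_mul_I, one_mul, Complex.norm_real,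
      Real.norm_of_nonneg (Real.exp_pos _).le]
  have hsub := fun ξ : Space3 => integral_subordination hs (energy_pos hm ((2 * Real.pi) • ξ))
  -- The character has modulus one, so by subordination the `u`-integral of `‖K‖` is a multiple of
  -- `exp (-sω)`, which is integrable in `ξ`.
  have hKi : Integrable (Function.uncurry K) (volume.prod volume) := by
    have hc := continuous_energy m
    have hKc : Continuous (Function.uncurry K) := by
      simp only [K, Function.uncurry_def]
      fun_prop
    rw [integrable_prod_iff hKc.aestronglyMeasurable]
    simp only [Function.uncurry_apply_pair]
    refine ⟨Eventually.of_forall fun ξ => ?_, ?_⟩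
    · exact (hsub ξ).1.ofReal.const_mul _
    · simp only [hKn, (hsub _).2]
      refine ((integrable_exp_neg_energy m hs).const_mul (2 * Real.sqrt Real.pi / s)).congr
        (Eventually.of_forall fun ξ => ?_)
      simp only [mul_comm s]
  have hsπ : 0 < Real.sqrt Real.pi := Real.sqrt_pos.2 Real.pi_pos
  have hleft : 𝓕⁻ (timePhase m (-(Complex.I * s))) w =
      ((s / (2 * Real.sqrt Real.pi) : ℝ) : ℂ) * ∫ ξ, ∫ u, K ξ u := by
    rw [Real.fourierInv_eq', ← integral_const_mul]
    refine integral_congr_ae (Eventually.of_forall fun ξ => ?_)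
    simp only [K, smul_eq_mul]
    rw [integral_const_mul, integral_complex_ofReal, (hsub ξ).2, mul_left_comm,
      ← Complex.ofReal_mul, ← mul_assoc (s / _),
      show s / (2 * Real.sqrt Real.pi) * (2 * Real.sqrt Real.pi / s) = 1 by field_simp, one_mul,
      timePhase, Complex.ofReal_exp]
    congr 2
    · push_cast
      ring
    · push_cast
      linear_combination (energy m ((2 * Real.pi) • ξ) : ℂ) * s * Complex.I_sq
  have hinner : ∀ u, ∫ ξ, K ξ u = (((4 * Real.pi) ^ (-(3 / 2) : ℝ) *
      Real.exp (-2 * u - Real.sqrt (‖w‖ ^ 2 + s ^ 2) ^ 2 * Real.exp (-u) / 4 -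
        m ^ 2 * Real.exp u) : ℝ) : ℂ) := fun u => by
    have e : ∀ ξ, K ξ u = ((Real.exp (-(1 / 2) * u - s ^ 2 * Real.exp (-u) / 4 -
        m ^ 2 * Real.exp u) : ℝ) : ℂ) *
        (Complex.exp (2 * Real.pi * Complex.I * (inner ℝ ξ w : ℝ)) *
          ((Real.exp (-(Real.exp u * ‖(2 * Real.pi) • ξ‖ ^ 2)) : ℝ) : ℂ)) := fun ξ => by
      simp only [K]
      rw [mul_left_comm, ← Complex.ofReal_mul, ← Real.exp_add, energy_sq]
      congr 3
      ring
    simp only [e]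
    rw [integral_const_mul, fourierInv_exp_neg_mul_sq (Real.exp_pos u), ← Complex.ofReal_mul,
      Real.mul_rpow (by positivity) (Real.exp_pos u).le, ← Real.exp_mul, mul_assoc, mul_left_comm,
      ← Real.exp_add, ← Real.exp_add, Real.sq_sqrt (by positivity), Real.exp_neg u]
    congr 3
    ring
  have hR : 0 < Real.sqrt (‖w‖ ^ 2 + s ^ 2) := Real.sqrt_pos.2 (by positivity)
  have hRsq : ((Real.sqrt (‖w‖ ^ 2 + s ^ 2) : ℝ) : ℂ) ^ 2 = (‖w‖ : ℂ) ^ 2 + (s : ℂ) ^ 2 := by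
    rw [← Complex.ofReal_pow, Real.sq_sqrt (by positivity)]
    push_cast
    rfl
  rw [hleft, integral_integral_swap hKi]
  simp only [hinner]
  rw [integral_complex_ofReal, integral_const_mul, Complex.ofReal_mul,
    integral_exp_eq_besselK hR hm, timeKernel]
  have e1 : ((‖w‖ : ℂ) ^ 2 - (-(Complex.I * s)) ^ 2) = ((‖w‖ ^ 2 + s ^ 2 : ℝ) : ℂ) := by
    push_cast
    rw [neg_sq, mul_pow, Complex.I_sq]
    ring
  have e2 : (((‖w‖ ^ 2 + s ^ 2 : ℝ) : ℂ)) ^ (1 / 2 : ℂ) =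
      ((Real.sqrt (‖w‖ ^ 2 + s ^ 2) : ℝ) : ℂ) := by
    rw [Real.sqrt_eq_rpow, Complex.ofReal_cpow (by positivity)]
    push_cast
    rfl
  have e3 : (4 * Real.pi) ^ (-(3 / 2) : ℝ) = (8 * Real.pi * Real.sqrt Real.pi)⁻¹ := by
    rw [Real.rpow_neg (by positivity), show (3 / 2 : ℝ) = 1 + 1 / 2 by norm_num,
      Real.rpow_add (by positivity), Real.rpow_one, ← Real.sqrt_eq_rpow,
      show 4 * Real.pi = 2 ^ 2 * Real.pi by norm_num, Real.sqrt_mul (by positivity),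
      Real.sqrt_sq two_pos.le]
    ring_nf
  have hz : (0 : ℝ) < ((m : ℂ) * ((Real.sqrt (‖w‖ ^ 2 + s ^ 2) : ℝ) : ℂ)).re := by
    rw [← Complex.ofReal_mul, Complex.ofReal_re]
    positivity
  rw [e1, e2, besselK, if_pos hz, e3, mul_comm (Real.sqrt (‖w‖ ^ 2 + s ^ 2)) m,
    Complex.ofReal_mul m]
  have hRc : ((Real.sqrt (‖w‖ ^ 2 + s ^ 2) : ℝ) : ℂ) ≠ 0 := by exact_mod_cast hR.ne'
  have hππ : ((Real.sqrt Real.pi : ℝ) : ℂ) ^ 2 = Real.pi := by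
    rw [← Complex.ofReal_pow, Real.sq_sqrt Real.pi_pos.le]
  have hsπc : ((Real.sqrt Real.pi : ℝ) : ℂ) ≠ 0 := by exact_mod_cast hsπ.ne'
  have hI : Complex.I * -(Complex.I * s) = s := by
    rw [mul_neg, ← mul_assoc, Complex.I_mul_I]
    ring
  rw [hI, show ((‖w‖ ^ 2 + s ^ 2 : ℝ) : ℂ) = ((Real.sqrt (‖w‖ ^ 2 + s ^ 2) : ℝ) : ℂ) ^ 2 by
    rw [hRsq]; push_cast; rfl]
  push_cast
  rw [← hππ]
  field_simp

end KernelFourier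

/-! ### Analytic continuation to the lower half plane of times -/

section KernelContinuation

theorem cpow_half_sq (v : ℂ) : (v ^ (1 / 2 : ℂ)) ^ 2 = v := by
  have h := Complex.cpow_nat_inv_pow v two_ne_zero
  rwa [Nat.cast_ofNat, ← one_div] at h

theorem re_cpow_half_pos {v : ℂ} (hv : v ∈ Complex.slitPlane) : 0 < (v ^ (1 / 2 : ℂ)).re := by
  rw [Complex.cpow_def_of_ne_zero (Complex.slitPlane_ne_zero hv), Complex.exp_re]
  refine mul_pos (Real.exp_pos _) (Real.cos_pos_of_mem_Ioo ?_)
  have e : (Complex.log v * (1 / 2)).im = v.arg / 2 := by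
    rw [show (1 / 2 : ℂ) = ((1 / 2 : ℝ) : ℂ) by push_cast; rfl, Complex.im_mul_ofReal,
      Complex.log_im]
    ring
  rw [e]
  have h1 := Complex.neg_pi_lt_arg v
  have h2 := lt_of_le_of_ne (Complex.arg_le_pi v) (Complex.mem_slitPlane_iff_arg.1 hv).1
  constructor <;> linarith

theorem sq_sub_sq_re (r : ℝ) (ζ : ℂ) :
    ((r : ℂ) ^ 2 - ζ ^ 2).re = r ^ 2 - ζ.re ^ 2 + ζ.im ^ 2 := by
  simp [sq]
  ring

theorem sq_sub_sq_im (r : ℝ) (ζ : ℂ) : ((r : ℂ) ^ 2 - ζ ^ 2).im = -2 * ζ.re * ζ.im := by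
  simp [sq]
  ring

/-- The imaginary part `-2 Re ζ Im ζ` vanishes only for `Re ζ = 0`, and then the real part is `r² +
(Im ζ)² > 0`. So the principal root meets no branch cut. -/
theorem sq_sub_sq_mem_slitPlane (r : ℝ) {ζ : ℂ} (hζ : ζ.im < 0) :
    (r : ℂ) ^ 2 - ζ ^ 2 ∈ Complex.slitPlane := by
  rw [Complex.mem_slitPlane_iff, sq_sub_sq_re, sq_sub_sq_im]
  by_cases h : ζ.re = 0
  · left
    rw [h]
    nlinarith [sq_nonneg r]
  · right
    simp [h, hζ.ne]

theorem re_mul_root_pos {m : ℝ} (hm : 0 < m) (r : ℝ) {ζ : ℂ} (hζ : ζ.im < 0) :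
    0 < ((m : ℂ) * ((r : ℂ) ^ 2 - ζ ^ 2) ^ (1 / 2 : ℂ)).re := by
  rw [Complex.re_ofReal_mul]
  exact mul_pos hm (re_cpow_half_pos (sq_sub_sq_mem_slitPlane r hζ))

theorem timeKernel_of_im_neg {m : ℝ} (hm : 0 < m) {ζ : ℂ} (hζ : ζ.im < 0) (w : Space3) :
    timeKernel m ζ w = Complex.I * ζ / (2 * (Real.pi : ℂ) ^ 2) *
      ((m : ℂ) ^ 2 * besselKIntegral 2 (m * ((‖w‖ : ℂ) ^ 2 - ζ ^ 2) ^ (1 / 2 : ℂ)) /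
        ((‖w‖ : ℂ) ^ 2 - ζ ^ 2)) := by
  rw [timeKernel, besselK, if_pos (re_mul_root_pos hm _ hζ)]

theorem differentiableOn_timeKernel {m : ℝ} (hm : 0 < m) (w : Space3) :
    DifferentiableOn ℂ (fun ζ => timeKernel m ζ w) {ζ | ζ.im < 0} := by
  refine DifferentiableOn.congr (fun ζ hζ => ?_) fun ζ hζ => timeKernel_of_im_neg hm hζ w
  have hs := sq_sub_sq_mem_slitPlane ‖w‖ hζ
  have hv : DifferentiableAt ℂ (fun ζ : ℂ => (‖w‖ : ℂ) ^ 2 - ζ ^ 2) ζ := by fun_prop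
  have hroot := (hv.cpow_const (c := (1 / 2 : ℂ)) hs).const_mul (m : ℂ)
  have hK := (differentiableAt_besselKIntegral (re_mul_root_pos hm ‖w‖ hζ)).comp ζ hroot
  have hpre : DifferentiableAt ℂ (fun ζ : ℂ => Complex.I * ζ / (2 * (Real.pi : ℂ) ^ 2)) ζ := by
    fun_prop
  exact (hpre.mul ((hK.const_mul ((m : ℂ) ^ 2)).div hv
    (Complex.slitPlane_ne_zero hs))).differentiableWithinAt

theorem continuous_timeKernel {m : ℝ} (hm : 0 < m) {ζ : ℂ} (hζ : ζ.im < 0) :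
    Continuous (timeKernel m ζ) := by
  rw [show timeKernel m ζ = _ from funext (timeKernel_of_im_neg hm hζ)]
  have hv : Continuous fun w : Space3 => (‖w‖ : ℂ) ^ 2 - ζ ^ 2 := by fun_prop
  have hroot : Continuous fun w : Space3 =>
      (m : ℂ) * ((‖w‖ : ℂ) ^ 2 - ζ ^ 2) ^ (1 / 2 : ℂ) :=
    continuous_const.mul (hv.cpow continuous_const fun w => sq_sub_sq_mem_slitPlane ‖w‖ hζ)
  have hK : Continuous fun w : Space3 =>
      besselKIntegral 2 (m * ((‖w‖ : ℂ) ^ 2 - ζ ^ 2) ^ (1 / 2 : ℂ)) :=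
    continuous_iff_continuousAt.2 fun w =>
      ContinuousAt.comp (f := fun w : Space3 => (m : ℂ) * ((‖w‖ : ℂ) ^ 2 - ζ ^ 2) ^ (1 / 2 : ℂ))
        (differentiableAt_besselKIntegral (re_mul_root_pos hm ‖w‖ hζ)).continuousAt
        hroot.continuousAt
  exact continuous_const.mul ((continuous_const.mul hK).div hv
    fun w => Complex.slitPlane_ne_zero (sq_sub_sq_mem_slitPlane ‖w‖ hζ))

/-- For large `‖w‖` the root of `v = ‖w‖² - ζ²` satisfies `(Re √v)² ≥ Re v ≥ ‖w‖²/2`, so the bound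
`192 / (Re z)⁴` on `K₂` already gives decay of order `4`. -/
theorem integrable_timeKernel {m : ℝ} (hm : 0 < m) {ζ : ℂ} (hζ : ζ.im < 0) :
    Integrable (timeKernel m ζ) := by
  refine (continuous_timeKernel hm hζ).locallyIntegrable.integrable_of_isBigO_cocompact
    (g := fun w : Space3 => (1 + ‖w‖) ^ (-4 : ℝ)) ?_
    (integrable_one_add_norm_four.integrableAtFilter _)
  -- The last factors come from `1/‖v‖ ≤ 2` and from `1 + ‖w‖ ≤ 2‖w‖` raised to the fourth power.
  refine Asymptotics.IsBigO.of_bound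
    (‖Complex.I * ζ / (2 * (Real.pi : ℂ) ^ 2)‖ * (m ^ 2 * (192 / m ^ 4 * 4) * 2 * 16)) ?_
  filter_upwards [tendsto_norm_cocompact_atTop.eventually_ge_atTop (1 + 2 * |ζ.re|)] with w hw
  set v : ℂ := (‖w‖ : ℂ) ^ 2 - ζ ^ 2 with hv
  have hw1 : 1 ≤ ‖w‖ := by linarith [abs_nonneg ζ.re]
  have hvre : ‖w‖ ^ 2 / 2 ≤ v.re := by
    rw [hv, sq_sub_sq_re]
    nlinarith [abs_nonneg ζ.re, sq_abs ζ.re, sq_nonneg ζ.im]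
  have hvn : 1 / 2 ≤ ‖v‖ := by
    have := Complex.re_le_norm v
    nlinarith
  have hpos := re_mul_root_pos hm ‖w‖ hζ
  rw [← hv] at hpos
  have hre : ‖w‖ ^ 4 / 4 * m ^ 4 ≤ ((m : ℂ) * v ^ (1 / 2 : ℂ)).re ^ 4 := by
    have h1 : v.re = (v ^ (1 / 2 : ℂ)).re ^ 2 - (v ^ (1 / 2 : ℂ)).im ^ 2 := by
      conv_lhs => rw [← cpow_half_sq v]
      rw [sq, Complex.mul_re, sq, sq]
    have h2 : ‖w‖ ^ 2 / 2 ≤ (v ^ (1 / 2 : ℂ)).re ^ 2 := by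
      nlinarith [sq_nonneg (v ^ (1 / 2 : ℂ)).im]
    have h3 := pow_le_pow_left₀ (by positivity) h2 2
    rw [Complex.re_ofReal_mul, mul_pow]
    nlinarith [pow_pos hm 4]
  have hK : ‖besselKIntegral 2 ((m : ℂ) * v ^ (1 / 2 : ℂ))‖ ≤ 192 / (‖w‖ ^ 4 / 4 * m ^ 4) :=
    (norm_besselKIntegral_le hpos).trans
      (div_le_div_of_nonneg_left (by norm_num) (by positivity) hre)
  rw [timeKernel_of_im_neg hm hζ, norm_mul, mul_assoc ‖Complex.I * ζ / _‖]
  refine mul_le_mul_of_nonneg_left ?_ (norm_nonneg _)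
  rw [← hv, norm_div, norm_mul, norm_pow, Complex.norm_real, Real.norm_of_nonneg hm.le,
    Real.norm_of_nonneg (by positivity), Real.rpow_neg (by positivity),
    show (4 : ℝ) = ((4 : ℕ) : ℝ) by norm_num, Real.rpow_natCast]
  have h4 : (1 + ‖w‖) ^ 4 ≤ 16 * ‖w‖ ^ 4 := by
    have := pow_le_pow_left₀ (by positivity) (show 1 + ‖w‖ ≤ 2 * ‖w‖ by linarith) 4
    rw [mul_pow] at this
    norm_num at this
    exact this
  have h5 : (‖w‖ ^ 4)⁻¹ ≤ 16 * ((1 + ‖w‖) ^ 4)⁻¹ := by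
    rw [← div_eq_mul_inv, inv_le_comm₀ (by positivity) (by positivity), inv_div,
      div_le_iff₀ (by norm_num)]
    linarith
  calc m ^ 2 * ‖besselKIntegral 2 ((m : ℂ) * v ^ (1 / 2 : ℂ))‖ / ‖v‖
      ≤ m ^ 2 * (192 / (‖w‖ ^ 4 / 4 * m ^ 4)) / (1 / 2) :=
        div_le_div₀ (by positivity) (mul_le_mul_of_nonneg_left hK (by positivity)) (by norm_num) hvn
    _ = m ^ 2 * (192 / m ^ 4 * 4) * 2 * (‖w‖ ^ 4)⁻¹ := by
        field_simp
    _ ≤ m ^ 2 * (192 / m ^ 4 * 4) * 2 * (16 * ((1 + ‖w‖) ^ 4)⁻¹) :=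
        mul_le_mul_of_nonneg_left h5 (by positivity)
    _ = _ := by
        push_cast
        ring

theorem differentiableOn_fourierInv_timePhase (m : ℝ) (w : Space3) :
    DifferentiableOn ℂ (fun ζ => 𝓕⁻ (timePhase m ζ) w) {ζ | ζ.im < 0} := by
  intro ζ hζ
  simp only [Real.fourierInv_eq', smul_eq_mul]
  -- On the ball of radius `a` the integrand is at most `exp (-2aω)`. One factor `exp (-aω)` absorbs
  -- the `ω` from the derivative, the other stays integrable.
  obtain ⟨a, ha, hζa⟩ : ∃ a > 0, ζ.im = -(3 * a) :=
    ⟨-ζ.im / 3, by linarith [show ζ.im < 0 from hζ], by ring⟩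
  have hball : ∀ z ∈ Metric.ball ζ a, z.im ≤ -(2 * a) := by
    intro z hz
    have h := (Complex.abs_im_le_norm (z - ζ)).trans (mem_ball_iff_norm.1 hz).le
    rw [Complex.sub_im] at h
    linarith [(abs_le.1 h).2]
  have hc := continuous_energy m
  have hphase : ∀ ξ : Space3, ‖Complex.exp (((2 * Real.pi * inner ℝ ξ w : ℝ) : ℂ) * Complex.I)‖ = 1 :=
    fun ξ => Complex.norm_exp_ofReal_mul_I _
  refine (hasDerivAt_integral_of_dominated_loc_of_deriv_le
    (F' := fun z ξ => Complex.exp (((2 * Real.pi * inner ℝ ξ w : ℝ) : ℂ) * Complex.I) *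
      (timePhase m z ξ * -(Complex.I * energy m ((2 * Real.pi) • ξ))))
    (bound := fun ξ => Real.exp (-(energy m ((2 * Real.pi) • ξ) * a)) * a⁻¹)
    (Metric.ball_mem_nhds ζ ha) ?_ ?_ ?_ ?_ ?_ ?_).2.differentiableAt.differentiableWithinAt
  · refine Eventually.of_forall fun z => Continuous.aestronglyMeasurable ?_
    have := continuous_timePhase m z
    fun_prop
  · refine (integrable_timePhase m hζ).bdd_mul (c := 1) (Continuous.aestronglyMeasurable ?_)
      (Eventually.of_forall fun ξ => (hphase ξ).le)
    fun_prop
  · refine Continuous.aestronglyMeasurable ?_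
    have := continuous_timePhase m ζ
    fun_prop
  · refine Eventually.of_forall fun ξ z hz => ?_
    have hω : 0 ≤ energy m ((2 * Real.pi) • ξ) := Real.sqrt_nonneg _
    rw [norm_mul, hphase, one_mul, norm_mul, norm_timePhase, norm_neg, norm_mul, Complex.norm_I,
      one_mul, Complex.norm_real, Real.norm_of_nonneg hω]
    have h1 : energy m ((2 * Real.pi) • ξ) ≤ Real.exp (energy m ((2 * Real.pi) • ξ) * a) * a⁻¹ := by
      rw [← div_eq_mul_inv, le_div_iff₀ ha]
      linarith [Real.add_one_le_exp (energy m ((2 * Real.pi) • ξ) * a)]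
    refine (mul_le_mul_of_nonneg_left h1 (Real.exp_pos _).le).trans ?_
    rw [← mul_assoc, ← Real.exp_add]
    refine mul_le_mul_of_nonneg_right (Real.exp_le_exp.2 ?_) (by positivity)
    nlinarith [hball z hz]
  · exact (integrable_exp_neg_energy m ha).mul_const _
  · refine Eventually.of_forall fun ξ z _ => ?_
    have h := ((hasDerivAt_id z).const_mul (Complex.I * energy m ((2 * Real.pi) • ξ))).neg.cexp.const_mul
      (Complex.exp (((2 * Real.pi * inner ℝ ξ w : ℝ) : ℂ) * Complex.I))
    simp only [mul_one] at h
    exact h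

/-- The time translation kernel is the inverse Fourier transform of `exp (-i ζ ω)`. -/
theorem fourierInv_timePhase {m : ℝ} (hm : 0 < m) {ζ : ℂ} (hζ : ζ.im < 0) (w : Space3) :
    𝓕⁻ (timePhase m ζ) w = timeKernel m ζ w := by
  have hopen : IsOpen {ζ : ℂ | ζ.im < 0} := isOpen_lt Complex.continuous_im continuous_const
  have h0 : -(Complex.I * (1 : ℝ)) ∈ {ζ : ℂ | ζ.im < 0} := by simp
  refine AnalyticOnNhd.eqOn_of_preconnected_of_frequently_eq
    ((differentiableOn_fourierInv_timePhase m w).analyticOnNhd hopen)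
    ((differentiableOn_timeKernel hm w).analyticOnNhd hopen)
    (convex_halfSpace_im_lt 0).isPreconnected h0 ?_ hζ
  -- The points `-is` with `s ↓ 1`, where equality is known, accumulate at `-i`.
  have ht : Tendsto (fun s : ℝ => -(Complex.I * s)) (𝓝[>] 1) (𝓝[≠] (-(Complex.I * (1 : ℝ)))) := by
    refine tendsto_nhdsWithin_iff.2 ⟨?_, ?_⟩
    · exact (Continuous.tendsto (by fun_prop) (1 : ℝ)).mono_left nhdsWithin_le_nhds
    · filter_upwards [self_mem_nhdsWithin] with s hs h
      have h' := neg_injective h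
      have := mul_left_cancel₀ Complex.I_ne_zero h'
      exact (ne_of_gt hs) (by exact_mod_cast this)
  refine ht.frequently (Eventually.frequently ?_)
  filter_upwards [self_mem_nhdsWithin] with s hs
  exact fourierInv_timePhase_neg_I hm (zero_lt_one.trans hs) w

/-- The Fourier integral moves from one factor to the other; the negated inner product as pairing
makes it the inverse transform. -/
theorem integral_timeKernel_mul {m : ℝ} (hm : 0 < m) {ζ : ℂ} (hζ : ζ.im < 0) (f : 𝓢(Space3, ℂ)) :
    ∫ w, timeKernel m ζ w * f w = ∫ ξ, timePhase m ζ ξ * 𝓕⁻ f ξ := by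
  have h := VectorFourier.integral_fourierIntegral_smul_eq_flip (e := Real.fourierChar)
    (L := -innerₗ Space3) (μ := volume) (ν := volume) (f := timePhase m ζ) (g := f)
    Real.continuous_fourierChar (by simp only [LinearMap.neg_apply, innerₗ_apply_apply]; fun_prop)
    (integrable_timePhase m hζ) f.integrable
  have hflip : (-innerₗ Space3).flip = -innerₗ Space3 := by
    ext x y
    simp [real_inner_comm]
  rw [hflip] at h
  simp only [← fourierInv_timePhase hm hζ]
  rw [SchwartzMap.fourierInv_coe]
  exact h

theorem tendsto_integral_timeKernel {m : ℝ} (hm : 0 < m) (t : ℝ) (f : 𝓢(Space3, ℂ)) :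
    Tendsto (fun ε : ℝ => ∫ w : Space3, timeKernel m (t - ε * Complex.I) w * f w)
      (𝓝[>] 0) (𝓝 (timeDistribution hm t f)) := by
  rw [timeDistribution_apply]
  have h : Tendsto (fun ε : ℝ => ∫ ξ, timePhase m (t - ε * Complex.I) ξ * 𝓕⁻ f ξ)
      (𝓝[>] 0) (𝓝 (∫ ξ, timePhase m t ξ * 𝓕⁻ f ξ)) := by
    refine tendsto_integral_filter_of_dominated_convergence (fun ξ => ‖𝓕⁻ f ξ‖)
      (Eventually.of_forall fun ε => ((continuous_timePhase m _).mul
        (𝓕⁻ f).continuous).aestronglyMeasurable) ?_ (𝓕⁻ f).integrable.norm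
      (Eventually.of_forall fun ξ => ?_)
    · filter_upwards [self_mem_nhdsWithin] with ε hε
      refine Eventually.of_forall fun ξ => ?_
      rw [norm_mul, norm_timePhase]
      refine mul_le_of_le_one_left (norm_nonneg _) (Real.exp_le_one_iff.2 ?_)
      have hω : 0 ≤ energy m ((2 * Real.pi) • ξ) := Real.sqrt_nonneg _
      have : ((t : ℂ) - ε * Complex.I).im = -ε := by simp
      rw [this]
      nlinarith [show (0 : ℝ) < ε from hε]
    · have hcont : Continuous fun ε : ℝ => timePhase m (t - ε * Complex.I) ξ * 𝓕⁻ f ξ := by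
        unfold timePhase
        fun_prop
      have := (hcont.tendsto 0).mono_left (nhdsWithin_le_nhds (s := Set.Ioi 0))
      simpa using this
  refine h.congr' ?_
  filter_upwards [self_mem_nhdsWithin] with ε hε
  exact (integral_timeKernel_mul hm (by simpa using hε) f).symm

end KernelContinuation

/-! ### Boundary values off the light cone -/

section BoundaryValue

/-- Both sides square to `v`, and the opposite sign would give `Im v = 2 Re r Im r` the sign of
`-σ`. Inside the cone `v` tends to the branch cut, whereas `-v` tends to the positive axis, where
the root is continuous. -/
theorem cpow_half_eq_I_mul {v : ℂ} {σ : ℝ} (hσ : σ ^ 2 = 1) (hv : 0 < σ * v.im) :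
    v ^ (1 / 2 : ℂ) = Complex.I * σ * (-v) ^ (1 / 2 : ℂ) := by
  have hv0 : v.im ≠ 0 := fun h => by simp [h] at hv
  have hr := re_cpow_half_pos (Complex.mem_slitPlane_iff.2 (Or.inr hv0))
  have hq := re_cpow_half_pos (v := -v) (Complex.mem_slitPlane_iff.2 (Or.inr (by simpa using hv0)))
  have hr2 := cpow_half_sq v
  have hq2 := cpow_half_sq (-v)
  set r := v ^ (1 / 2 : ℂ)
  set q := (-v) ^ (1 / 2 : ℂ)
  have hσc : (σ : ℂ) ^ 2 = 1 := by exact_mod_cast hσ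
  have hsq : r ^ 2 = (Complex.I * σ * q) ^ 2 := by
    rw [mul_pow, mul_pow, Complex.I_sq, hσc, hq2, hr2]
    ring
  rcases sq_eq_sq_iff_eq_or_eq_neg.1 hsq with h | h
  · exact h
  · exfalso
    have him : r.im = -(σ * q.re) := by
      rw [h]
      simp [mul_assoc]
    have hvim : v.im = 2 * r.re * r.im := by
      rw [← hr2, sq, Complex.mul_im]
      ring
    rw [hvim, him] at hv
    have : 0 < r.re * q.re := mul_pos hr hq
    nlinarith

theorem timeShift_im (t ε : ℝ) : ((t : ℂ) - ε * Complex.I).im = -ε := by simp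

theorem timeShift_re (t ε : ℝ) : ((t : ℂ) - ε * Complex.I).re = t := by simp

theorem tendsto_sq_sub_timeShift_sq (t : ℝ) (w : Space3) :
    Tendsto (fun ε : ℝ => (‖w‖ : ℂ) ^ 2 - (t - ε * Complex.I) ^ 2) (𝓝[>] 0)
      (𝓝 ((‖w‖ : ℂ) ^ 2 - (t : ℂ) ^ 2)) := by
  have hc : Continuous fun ε : ℝ => (‖w‖ : ℂ) ^ 2 - (t - ε * Complex.I) ^ 2 := by fun_prop
  simpa using (hc.tendsto 0).mono_left (nhdsWithin_le_nhds (s := Set.Ioi 0))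

theorem sqrt_eq_cpow_half {x : ℝ} (hx : 0 ≤ x) :
    ((Real.sqrt x : ℝ) : ℂ) = (x : ℂ) ^ (1 / 2 : ℂ) := by
  rw [Real.sqrt_eq_rpow, Complex.ofReal_cpow hx]
  push_cast
  rfl

/-- The principal root at time `t - iε` converges to the root on the light cone complement. -/
theorem tendsto_root_lightConeRoot {t : ℝ} {w : Space3} (hw : ‖w‖ ≠ |t|) :
    Tendsto (fun ε : ℝ => ((‖w‖ : ℂ) ^ 2 - (t - ε * Complex.I) ^ 2) ^ (1 / 2 : ℂ)) (𝓝[>] 0)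
      (𝓝 (lightConeRoot t w)) := by
  have hlim := tendsto_sq_sub_timeShift_sq t w
  rcases lt_or_gt_of_ne hw with h | h
  · have ht : t ≠ 0 := by
      rintro rfl
      simp only [abs_zero] at h
      exact absurd h (not_lt.2 (norm_nonneg w))
    have hpos : 0 < t ^ 2 - ‖w‖ ^ 2 := by
      rw [← sq_abs t]
      nlinarith [norm_nonneg w]
    have hsign : ((SignType.sign t : ℝ)) ^ 2 = 1 := by
      rcases lt_or_gt_of_ne ht with h | h <;> simp [h]
    have hsign' : 0 < (SignType.sign t : ℝ) * t := by
      rcases lt_or_gt_of_ne ht with h | h <;> simp [h]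
    rw [lightConeRoot, if_neg (not_le.2 h), sqrt_eq_cpow_half hpos.le]
    have hm : ((t ^ 2 - ‖w‖ ^ 2 : ℝ) : ℂ) ∈ Complex.slitPlane := Complex.ofReal_mem_slitPlane.2 hpos
    have hneg : Tendsto (fun ε : ℝ => -((‖w‖ : ℂ) ^ 2 - (t - ε * Complex.I) ^ 2)) (𝓝[>] 0)
        (𝓝 ((t ^ 2 - ‖w‖ ^ 2 : ℝ) : ℂ)) := by
      convert hlim.neg using 2
      push_cast
      ring
    refine ((hneg.cpow tendsto_const_nhds hm).const_mul _).congr' ?_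
    filter_upwards [self_mem_nhdsWithin] with ε hε
    refine (cpow_half_eq_I_mul hsign ?_).symm
    -- The imaginary part is `2tε`, which has the sign of `t`.
    rw [sq_sub_sq_im, timeShift_im, timeShift_re]
    have := mul_pos hsign' (show (0 : ℝ) < ε from hε)
    nlinarith
  · have hpos : 0 < ‖w‖ ^ 2 - t ^ 2 := by
      rw [← sq_abs t]
      nlinarith [abs_nonneg t]
    rw [lightConeRoot, if_pos h.le, sqrt_eq_cpow_half hpos.le]
    have hm : ((‖w‖ ^ 2 - t ^ 2 : ℝ) : ℂ) ∈ Complex.slitPlane := Complex.ofReal_mem_slitPlane.2 hpos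
    refine Tendsto.cpow ?_ tendsto_const_nhds hm
    convert hlim using 2
    push_cast
    rfl

theorem lightConeRoot_sq (t : ℝ) (w : Space3) :
    lightConeRoot t w ^ 2 = (‖w‖ : ℂ) ^ 2 - (t : ℂ) ^ 2 := by
  rw [lightConeRoot]
  split_ifs with h
  · have : 0 ≤ ‖w‖ ^ 2 - t ^ 2 := by
      rw [← sq_abs t]
      nlinarith [abs_nonneg t]
    rw [← Complex.ofReal_pow, Real.sq_sqrt this]
    push_cast
    rfl
  · have h' : ‖w‖ < |t| := not_le.1 h
    have hpos : 0 ≤ t ^ 2 - ‖w‖ ^ 2 := by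
      rw [← sq_abs t]
      nlinarith [norm_nonneg w]
    have ht : t ≠ 0 := by
      rintro rfl
      simp only [abs_zero] at h'
      exact absurd h' (not_lt.2 (norm_nonneg w))
    have hsign : (((SignType.sign t : ℝ)) : ℂ) ^ 2 = 1 := by
      rcases lt_or_gt_of_ne ht with h | h <;> simp [h]
    rw [mul_pow, mul_pow, Complex.I_sq, hsign, ← Complex.ofReal_pow, Real.sq_sqrt hpos]
    push_cast
    ring

theorem sq_sub_sq_ne_zero {t : ℝ} {w : Space3} (hw : ‖w‖ ≠ |t|) :
    (‖w‖ : ℂ) ^ 2 - (t : ℂ) ^ 2 ≠ 0 := by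
  have h : ‖w‖ ^ 2 - t ^ 2 ≠ 0 := fun h => hw <| by
    rw [← abs_of_nonneg (norm_nonneg w)]
    exact (sq_eq_sq_iff_abs_eq_abs _ _).1 (sub_eq_zero.1 h)
  exact_mod_cast h

theorem tendsto_timeKernel {m : ℝ} (hm : 0 < m) {t : ℝ} {w : Space3} (hw : ‖w‖ ≠ |t|) :
    Tendsto (fun ε : ℝ => timeKernel m (t - ε * Complex.I) w) (𝓝[>] 0)
      (𝓝 (realTimeKernel m t w)) := by
  have hroot := (tendsto_root_lightConeRoot hw).const_mul (m : ℂ)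
  have hne := sq_sub_sq_ne_zero hw
  have hz0 : (m : ℂ) * lightConeRoot t w ≠ 0 := by
    refine mul_ne_zero (by exact_mod_cast hm.ne') fun h => hne ?_
    rw [← lightConeRoot_sq, h]
    simp
  have hmem : ∀ᶠ ε : ℝ in 𝓝[>] 0,
      (m : ℂ) * ((‖w‖ : ℂ) ^ 2 - (t - ε * Complex.I) ^ 2) ^ (1 / 2 : ℂ) ∈
        {z : ℂ | 0 ≤ z.re ∧ z ≠ 0} := by
    filter_upwards [self_mem_nhdsWithin] with ε hε
    have h := re_mul_root_pos hm ‖w‖ (ζ := t - ε * Complex.I) (by simpa using hε)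
    exact ⟨h.le, fun h0 => by rw [h0] at h; simp at h⟩
  have hre : 0 ≤ ((m : ℂ) * lightConeRoot t w).re :=
    ge_of_tendsto ((Complex.continuous_re.tendsto _).comp hroot) (hmem.mono fun ε h => h.1)
  have hK := (continuousOn_besselK _ ⟨hre, hz0⟩).tendsto.comp
    (tendsto_nhdsWithin_iff.2 ⟨hroot, hmem⟩)
  have hpre : Tendsto (fun ε : ℝ => Complex.I * (t - ε * Complex.I) / (2 * (Real.pi : ℂ) ^ 2))
      (𝓝[>] 0) (𝓝 (Complex.I * t / (2 * (Real.pi : ℂ) ^ 2))) := by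
    have hc : Continuous fun ε : ℝ =>
      Complex.I * ((t : ℂ) - ε * Complex.I) / (2 * (Real.pi : ℂ) ^ 2) := by fun_prop
    simpa using (hc.tendsto 0).mono_left (nhdsWithin_le_nhds (s := Set.Ioi 0))
  exact hpre.mul ((hK.const_mul ((m : ℂ) ^ 2)).div (tendsto_sq_sub_timeShift_sq t w) hne)

/-- The time translation kernels at the times `t - iε`, `0 < ε ≤ 1`, are uniformly bounded on
compact sets that avoid the light cone. -/
theorem exists_norm_timeKernel_le {m : ℝ} (hm : 0 < m) (t : ℝ) {K : Set Space3} (hK : IsCompact K)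
    (hcone : ∀ w ∈ K, ‖w‖ ≠ |t|) :
    ∃ C, ∀ w ∈ K, ∀ ε ∈ Set.Ioc (0 : ℝ) 1, ‖timeKernel m (t - ε * Complex.I) w‖ ≤ C := by
  obtain ⟨δ, hδ, hδK⟩ := hK.exists_forall_le' (f := fun w => |‖w‖ ^ 2 - t ^ 2|) (a := 0)
    (by fun_prop) fun w hw => abs_pos.2 fun h => sq_sub_sq_ne_zero (hcone w hw) (by exact_mod_cast h)
  obtain ⟨B, hB⟩ := hK.exists_bound_of_continuousOn (f := fun w : Space3 => ‖w‖) (by fun_prop)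
  have hcont : Continuous fun z : ℂ => ‖z‖ ^ 2 := by fun_prop
  -- This half annulus avoids the origin and contains every argument `z = m√v` of `K₂` that occurs,
  -- because `‖z‖² = m²‖v‖`.
  have hcompact : IsCompact {z : ℂ | 0 ≤ z.re ∧ m ^ 2 * δ ≤ ‖z‖ ^ 2 ∧
      ‖z‖ ^ 2 ≤ m ^ 2 * (B ^ 2 + (|t| + 1) ^ 2)} := by
    refine Metric.isCompact_of_isClosed_isBounded ?_ ?_
    · exact (isClosed_le continuous_const Complex.continuous_re).inter
        ((isClosed_le continuous_const hcont).inter (isClosed_le hcont continuous_const))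
    · refine isBounded_iff_forall_norm_le.2 ⟨_, fun z hz => Real.le_sqrt_of_sq_le hz.2.2⟩
  obtain ⟨M, hM⟩ := hcompact.exists_bound_of_continuousOn (f := besselK 2)
    (continuousOn_besselK.mono fun z hz => ⟨hz.1, fun h => by
      have h1 := hz.2.1
      rw [h, norm_zero, zero_pow two_ne_zero] at h1
      exact absurd h1 (not_le.2 (by positivity))⟩)
  refine ⟨(|t| + 1) / (2 * Real.pi ^ 2) * (m ^ 2 * M / δ), fun w hw ε hε => ?_⟩
  have him : ((t : ℂ) - ε * Complex.I).im < 0 := by simpa using hε.1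
  set v : ℂ := (‖w‖ : ℂ) ^ 2 - (t - ε * Complex.I) ^ 2 with hv
  have hζ : ‖(t : ℂ) - ε * Complex.I‖ ≤ |t| + 1 := by
    refine (norm_sub_le _ _).trans (add_le_add (by simp) ?_)
    rw [norm_mul, Complex.norm_I, mul_one, Complex.norm_real, Real.norm_of_nonneg hε.1.le]
    exact hε.2
  have hvδ : δ ≤ ‖v‖ := by
    -- Factor `v = (‖w‖ + ζ)(‖w‖ - ζ)`; each factor has modulus at least that of its real part.
    refine (hδK w hw).trans ?_
    have h1 : |‖w‖ - t| ≤ ‖(‖w‖ : ℂ) - (t - ε * Complex.I)‖ := by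
      simpa using Complex.abs_re_le_norm ((‖w‖ : ℂ) - (t - ε * Complex.I))
    have h2 : |‖w‖ + t| ≤ ‖(‖w‖ : ℂ) + (t - ε * Complex.I)‖ := by
      simpa using Complex.abs_re_le_norm ((‖w‖ : ℂ) + (t - ε * Complex.I))
    rw [hv, sq_sub_sq, sq_sub_sq, norm_mul, abs_mul]
    exact mul_le_mul h2 h1 (abs_nonneg _) (norm_nonneg _)
  have hvB : ‖v‖ ≤ B ^ 2 + (|t| + 1) ^ 2 := by
    have hwB : ‖w‖ ≤ B := by simpa using hB w hw
    refine (norm_sub_le _ _).trans (add_le_add ?_ ?_)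
    · rw [norm_pow, Complex.norm_real, norm_norm]
      exact pow_le_pow_left₀ (norm_nonneg _) hwB 2
    · rw [norm_pow]
      exact pow_le_pow_left₀ (norm_nonneg _) hζ 2
  have hzn : ‖(m : ℂ) * v ^ (1 / 2 : ℂ)‖ ^ 2 = m ^ 2 * ‖v‖ := by
    rw [norm_mul, mul_pow, ← norm_pow (v ^ (1 / 2 : ℂ)), cpow_half_sq, Complex.norm_real,
      Real.norm_of_nonneg hm.le]
  have hbound : ‖besselK 2 ((m : ℂ) * v ^ (1 / 2 : ℂ))‖ ≤ M := by
    refine hM _ ⟨(re_mul_root_pos hm ‖w‖ him).le, ?_, ?_⟩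
    · rw [hzn]
      exact mul_le_mul_of_nonneg_left hvδ (by positivity)
    · rw [hzn]
      exact mul_le_mul_of_nonneg_left hvB (by positivity)
  have hM0 : 0 ≤ M := (norm_nonneg _).trans hbound
  rw [timeKernel, ← hv, norm_mul, norm_div, norm_div, norm_mul, norm_mul, norm_mul, norm_pow,
    norm_pow, Complex.norm_I, one_mul, Complex.norm_two, Complex.norm_real, Complex.norm_real,
    Real.norm_of_nonneg hm.le, Real.norm_of_nonneg Real.pi_pos.le]
  refine mul_le_mul (div_le_div_of_nonneg_right hζ (by positivity))
    (div_le_div₀ (by positivity) (mul_le_mul_of_nonneg_left hbound (by positivity)) hδ hvδ)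
    (by positivity) (by positivity)

/-- Both sides are the limit of the same integrals as `ε ↓ 0`: one by the momentum space argument,
the other by dominated convergence with bound `C ‖f‖`. -/
theorem timeDistribution_eq_integral {m : ℝ} (hm : 0 < m) (t : ℝ) (f : 𝓢(Space3, ℂ))
    (hf : HasCompactSupport f) (hcone : ∀ w ∈ tsupport f, ‖w‖ ≠ |t|) :
    Integrable (fun w : Space3 => realTimeKernel m t w * f w) volume ∧
      timeDistribution hm t f = ∫ w : Space3, realTimeKernel m t w * f w := by
  obtain ⟨C, hC⟩ := exists_norm_timeKernel_le hm t hf.isCompact hcone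
  have hfun : ∀ w, w ∉ tsupport f → f w = 0 := fun w hw => image_eq_zero_of_notMem_tsupport hw
  have hmeas : ∀ᶠ ε : ℝ in 𝓝[>] 0, AEStronglyMeasurable
      (fun w : Space3 => timeKernel m (t - ε * Complex.I) w * f w) volume := by
    filter_upwards [self_mem_nhdsWithin] with ε hε
    exact ((continuous_timeKernel hm (by simpa using hε)).mul f.continuous).aestronglyMeasurable
  have hlim : ∀ w, Tendsto (fun ε : ℝ => timeKernel m (t - ε * Complex.I) w * f w) (𝓝[>] 0)
      (𝓝 (realTimeKernel m t w * f w)) := fun w => by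
    by_cases hw : w ∈ tsupport f
    · exact (tendsto_timeKernel hm (hcone w hw)).mul_const _
    · simp [hfun w hw]
  have hbound : ∀ᶠ ε : ℝ in 𝓝[>] 0, ∀ w,
      ‖timeKernel m (t - ε * Complex.I) w * f w‖ ≤ C * ‖f w‖ := by
    filter_upwards [Ioc_mem_nhdsGT (zero_lt_one' ℝ)] with ε hε w
    by_cases hw : w ∈ tsupport f
    · rw [norm_mul]
      exact mul_le_mul_of_nonneg_right (hC w hw ε hε) (norm_nonneg _)
    · simp [hfun w hw]
  have hCf : Integrable (fun w : Space3 => C * ‖f w‖) volume := f.integrable.norm.const_mul C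
  refine ⟨hCf.mono' ?_ (Eventually.of_forall fun w => ?_), ?_⟩
  -- Measurability of the limit needs a sequence, shifted by `N` because the approximants are known
  -- to be measurable only eventually.
  · obtain ⟨u, hu⟩ := (𝓝[>] (0 : ℝ)).exists_seq_tendsto
    obtain ⟨N, hN⟩ := eventually_atTop.1 (hu.eventually hmeas)
    exact aestronglyMeasurable_of_tendsto_ae atTop (fun n => hN (n + N) (Nat.le_add_left N n))
      (Eventually.of_forall fun w => (hlim w).comp (hu.comp (tendsto_add_atTop_nat N)))
  · exact le_of_tendsto (hlim w).norm (hbound.mono fun ε h => h w)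
  · exact tendsto_nhds_unique (tendsto_integral_timeKernel hm t f)
      (tendsto_integral_filter_of_dominated_convergence _ hmeas
        (hbound.mono fun ε h => Eventually.of_forall h) hCf (Eventually.of_forall hlim))

end BoundaryValue

/-! ### The transformation law -/

theorem mainTheorem4 (m : ℝ) (hm : 0 < m) :
    (∀ t : ℝ, ∃ k : 𝓢'(Space3, ℂ),
      (∀ ε : ℝ, 0 < ε → Integrable (timeKernel m (t - ε * Complex.I)) volume) ∧
      (∀ f : 𝓢(Space3, ℂ),
        Tendsto (fun ε : ℝ => ∫ w : Space3, timeKernel m (t - ε * Complex.I) w * f w)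
          (𝓝[>] 0) (𝓝 (k f))) ∧
      (∀ w : Space3, ‖w‖ ≠ |t| →
        Tendsto (fun ε : ℝ => timeKernel m (t - ε * Complex.I) w)
          (𝓝[>] 0) (𝓝 (realTimeKernel m t w))) ∧
      (∀ f : 𝓢(Space3, ℂ), HasCompactSupport f → (∀ w ∈ tsupport f, ‖w‖ ≠ |t|) →
        Integrable (fun w : Space3 => realTimeKernel m t w * f w) volume ∧
        k f = ∫ w : Space3, realTimeKernel m t w * f w) ∧
      (∀ (y : Space3) (f : 𝓢(Space3, ℂ)), ∃ g : 𝓢(Space3, ℂ), IsConvolutionTest k y f g ∧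
        conjOp (translationU m t y) (coordAnnihilation m hm f) = coordAnnihilation m hm g)) ∧
    (∀ (y : Space3) (f : 𝓢(Space3, ℂ)),
      conjOp (translationU m 0 y) (coordAnnihilation m hm f) =
        coordAnnihilation m hm (SchwartzMap.compSubConstCLM ℂ y f)) := by
  refine ⟨fun t => ⟨timeDistribution hm t, fun ε hε => ?_, tendsto_integral_timeKernel hm t,
    fun w hw => tendsto_timeKernel hm hw, timeDistribution_eq_integral hm t, fun y f => ?_⟩,
    conjOp_translationU_zero hm⟩
  · exact integrable_timeKernel hm (by simpa using hε)
  · exact ⟨translatedTest m t y f, isConvolutionTest_translatedTest hm t y f,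
      conjOp_translationU_timeDistribution hm t y f⟩
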